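/- Let $\mathbb H^1=\mathbb R^3$ be the first Heisenberg group, with the left-invariant fields $X_1=\partial_x-\frac y2\partial_t$, $X_2=\partial_y+\frac x2\partial_t$, $T=\partial_t$ and the Riemannian metric for which they are orthonormal. Let $\mathcal S\subset\mathbb H^1$ be an oriented $C^2$ surface: near each of its points it is the zero set of a $C^2$ function $\phi$ whose Riemannian gradient $\boldsymbol N=\nabla\phi=X_1\phi\,X_1+X_2\phi\,X_2+T\phi\,T$ does not vanish and points to the side fixed by the orientation. Assume that the characteristic locus of $\mathcal S$ (the set of $g\in\mathcal S$ where $T_g\mathcal S=\mathrm{span}\{X_1(g),X_2(g)\}$) is empty. With such a local $\phi$, near each point of $\mathcal S$, put $$W=\sqrt{(X_1\phi)^2+(X_2\phi)^2},\quad \overline p=\frac{X_1\phi}{W},\quad \overline q=\frac{X_2\phi}{W},\quad \overline\omega=\frac{T\phi}{W},$$ $$Y=\boldsymbol\nu_H=\overline p X_1+\overline q X_2,\quad Z=\overline q X_1-\overline p X_2,\quad \mathcal H=X_1\overline p+X_2\overline q .$$ Let $\nabla^{H,\mathcal S}a=\nabla^H a-\langle\nabla^H a,\boldsymbol\nu_H\rangle\boldsymbol\nu_H$,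 where $\nabla^Ha=X_1a\,X_1+X_2a\,X_2$ is computed with any $C^2$ extension of $a$, and let $d\sigma_H=\frac{W}{|\boldsymbol N|}d\sigma$ be the $H$-perimeter measure of a surface, where $\sigma$ is its Riemannian surface measure. For a Borel set $E$ in a surface write $P_H(E)=\int_E d\sigma_H$, with $\sigma_H$ taken on that surface. Let $a\in C^2_0(\mathcal S)$, let $F_\lambda(g)=g+\lambda\,a(g)X_1(g)$ for $g\in\mathcal S$, and let $\mathcal S^\lambda=F_\lambda(\mathcal S)$ be the deformed surface. Let $E\subset\mathcal S$ be any Borel set which contains the support of $a$ and has $P_H(E)<\infty$ (for instance $E=\mathcal S$, if $P_H(\mathcal S)<\infty$). Then $P_H(F_\lambda(E))$, the $H$-perimeter of the portion $F_\lambda(E)$ of $\mathcal S^\lambda$, is finite for $\lambda$ near $0$ and is $C^2$ in $\lambda$ near $0$, both integrands below are $\sigma_H$-integrable on $\mathcal S$, and the second variation $$\mathcal V^H_{II}(\mathcal S;aX_1)=\frac{d^2}{d\lambda^2}P_H(F_\lambda(E))\Big|_{\lambda=0}$$ is given by $$\mathcal V^H_{II}(\mathcal S;aX_1)=\int_{\mathcal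 S}\overline p^2\,|\nabla^{H,\mathcal S}a|^2\,d\sigma_H+\int_{\mathcal S}a^2\Big\{(\overline pT\overline q+\overline qT\overline p)-\overline\omega(\overline pY\overline q+\overline qY\overline p)-\overline q^2\overline\omega^2-Z\overline\omega-\overline p\,\overline q\,\overline\omega\,\mathcal H\Big\}\,d\sigma_H .$$ -/

import Mathlib

open MeasureTheory Filter Topology Matrix

noncomputable section

namespace Heisenberg

/-- The underlying space of the first Heisenberg group, with coordinates `(x, y, t)` and group law
`(x, y, t) ∘ (x', y', t') = (x + x', y + y', t + t' + (x y' - x' y) / 2)`. -/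
abbrev Heis : Type := ℝ × ℝ × ℝ

/-- The left-invariant field `X₁ = ∂ₓ - (y/2) ∂ₜ`. -/
def X1 (g : Heis) : Heis := (1, 0, -(g.2.1 / 2))

/-- The left-invariant field `X₂ = ∂_y + (x/2) ∂ₜ`. -/
def X2 (g : Heis) : Heis := (0, 1, g.1 / 2)

/-- The left-invariant field `T = ∂ₜ`. -/
def T (_ : Heis) : Heis := (0, 0, 1)

/-- The derivative `V f` of a function along a vector field. -/
def along (V : Heis → Heis) (f : Heis → ℝ) (g : Heis) : ℝ := fderiv ℝ f g (V g)

/-- The coordinates of a vector `v` at `g` in the frame `X₁, X₂, T`, that is,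
`v = c 0 • X₁ g + c 1 • X₂ g + c 2 • T g`. The frame is orthonormal for the left-invariant
Riemannian metric, so these are the inner products of `v` with `X₁, X₂, T`. -/
def frameCoord (g v : Heis) : Fin 3 → ℝ :=
  ![v.1, v.2.1, v.2.2 + g.2.1 / 2 * v.1 - g.1 / 2 * v.2.1]

lemma frameCoord_spec (g v : Heis) :
    frameCoord g v 0 • X1 g + frameCoord g v 1 • X2 g + frameCoord g v 2 • T g = v := by
  obtain ⟨x, y, t⟩ := g
  obtain ⟨a, b, c⟩ := v
  simp only [frameCoord, X1, X2, T, Prod.smul_mk, Prod.mk_add_mk, smul_eq_mul]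
  refine Prod.ext ?_ (Prod.ext ?_ ?_) <;> simp
  ring

/-- The Riemannian gradient of `φ`, in the orthonormal frame `X₁, X₂, T`. -/
def rgrad (φ : Heis → ℝ) (g : Heis) : Fin 3 → ℝ :=
  ![along X1 φ g, along X2 φ g, along T φ g]

/-! ### The horizontal perimeter measure of a surface -/

/-- `θ`, on the open set `U` of the parameter plane, is a regular injective `C¹` parametrization
of a piece of `M`. -/
structure IsPatch (M : Set Heis) (U : Set (ℝ × ℝ)) (θ : ℝ × ℝ → Heis) : Prop where
  isOpen : IsOpen U
  contDiffOn : ContDiffOn ℝ 1 θ U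
  injOn : Set.InjOn θ U
  immersion : ∀ u ∈ U, Function.Injective (fderiv ℝ θ u)
  mapsTo : Set.MapsTo θ U M

/-- The Riemannian normal `θ_u × θ_v` of a parametrization, in the orthonormal frame. Its length
is the Riemannian area density. -/
def patchNormal (θ : ℝ × ℝ → Heis) (u : ℝ × ℝ) : Fin 3 → ℝ :=
  frameCoord (θ u) (fderiv ℝ θ u (1, 0)) ⨯₃ frameCoord (θ u) (fderiv ℝ θ u (0, 1))

/-- The horizontal perimeter of a parametrized piece, as a measure on its image. The Riemannian
surface measure is `dσ = |N| du dv`, with `N = θ_u × θ_v`, and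
`dσ_H = (√(⟨N, X₁⟩² + ⟨N, X₂⟩²) / |N|) dσ = √(⟨N, X₁⟩² + ⟨N, X₂⟩²) du dv`. -/
def patchPerimeter (U : Set (ℝ × ℝ)) (θ : ℝ × ℝ → Heis) : Measure Heis :=
  Measure.map θ ((volume.restrict U).withDensity fun u =>
    ENNReal.ofReal (Real.sqrt (patchNormal θ u 0 ^ 2 + patchNormal θ u 1 ^ 2)))

/-- The `H`-perimeter measure `σ_H` of a surface `M`: the least measure that dominates the
`H`-perimeter of every parametrized piece of `M`. On an embedded `C¹` surface the measures of
different pieces agree where the pieces overlap, and countably many pieces cover `M`, so that this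
is the measure on `M` which restricts to `patchPerimeter` on each piece. -/
def perimeter (M : Set Heis) : Measure Heis :=
  ⨆ P : {P : Set (ℝ × ℝ) × (ℝ × ℝ → Heis) // IsPatch M P.1 P.2}, patchPerimeter P.1.1 P.1.2

/-! ### Oriented surfaces -/

/-- An oriented `C²` surface: a set which near each of its points `g` is the zero set of a `C²`
function `φ g` with nonvanishing gradient, the gradients of all these functions pointing to the
same side of the surface. -/
structure OrientedC2Surface where
  /-- the set of points of the surface -/
  carrier : Set Heis
  /-- the neighbourhood of a point of the surface on which it is given by an equation -/
  dom : Heis → Set Heis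
  /-- the local defining functions -/
  φ : Heis → Heis → ℝ
  isOpen_dom : ∀ g ∈ carrier, IsOpen (dom g)
  mem_dom : ∀ g ∈ carrier, g ∈ dom g
  contDiffOn : ∀ g ∈ carrier, ContDiffOn ℝ 2 (φ g) (dom g)
  rgrad_ne_zero : ∀ g ∈ carrier, ∀ h ∈ dom g, rgrad (φ g) h ≠ 0
  inter_dom : ∀ g ∈ carrier, carrier ∩ dom g = {h ∈ dom g | φ g h = 0}
  oriented : ∀ g ∈ carrier, ∀ g' ∈ carrier, ∀ h ∈ carrier ∩ dom g ∩ dom g',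
    ∃ c : ℝ, 0 < c ∧ rgrad (φ g) h = c • rgrad (φ g') h

/-- The horizontal plane at `g`. -/
def horizontalPlane (g : Heis) : Submodule ℝ Heis := Submodule.span ℝ {X1 g, X2 g}

/-- The tangent plane of the surface at a point `g` of it. -/
def OrientedC2Surface.tangentPlane (S : OrientedC2Surface) (g : Heis) : Submodule ℝ Heis :=
  LinearMap.ker (fderiv ℝ (S.φ g) g : Heis →ₗ[ℝ] ℝ)

/-- The characteristic locus. -/
def OrientedC2Surface.charLocus (S : OrientedC2Surface) : Set Heis :=
  {g ∈ S.carrier | S.tangentPlane g = horizontalPlane g}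

/-! ### The geometric quantities, computed from a defining function `φ` in a neighbourhood -/

/-- `W = √(p² + q²)`, where `p = X₁φ` and `q = X₂φ`. -/
def W (φ : Heis → ℝ) (g : Heis) : ℝ := Real.sqrt (along X1 φ g ^ 2 + along X2 φ g ^ 2)

/-- `p̄ = X₁φ / W`. -/
def pbar (φ : Heis → ℝ) (g : Heis) : ℝ := along X1 φ g / W φ g

/-- `q̄ = X₂φ / W`. -/
def qbar (φ : Heis → ℝ) (g : Heis) : ℝ := along X2 φ g / W φ g

/-- `ω̄ = Tφ / W`. -/
def omegabar (φ : Heis → ℝ) (g : Heis) : ℝ := along T φ g / W φ g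

/-- The horizontal Gauss map `Y = ν_H = p̄ X₁ + q̄ X₂`. -/
def Y (φ : Heis → ℝ) (g : Heis) : Heis := pbar φ g • X1 g + qbar φ g • X2 g

/-- `Z = ν_H^⊥ = q̄ X₁ - p̄ X₂`. -/
def Z (φ : Heis → ℝ) (g : Heis) : Heis := qbar φ g • X1 g - pbar φ g • X2 g

/-- The horizontal mean curvature `X₁p̄ + X₂q̄`. -/
def meanCurvature (φ : Heis → ℝ) (g : Heis) : ℝ :=
  along X1 (pbar φ) g + along X2 (qbar φ) g

/-- `|∇^{H,S} f|²`, where `∇^{H,S} f = ∇^H f - ⟨∇^H f, ν_H⟩ ν_H` and `∇^H f = X₁f X₁ + X₂f X₂`. -/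
def tangentialGradSq (φ f : Heis → ℝ) (g : Heis) : ℝ :=
  (along X1 f g - (along X1 f g * pbar φ g + along X2 f g * qbar φ g) * pbar φ g) ^ 2 +
  (along X2 f g - (along X1 f g * pbar φ g + along X2 f g * qbar φ g) * qbar φ g) ^ 2

/-- The coefficient of `a²` in the second variation along `a X₁`. -/
def potential (φ : Heis → ℝ) (g : Heis) : ℝ :=
  (pbar φ g * along T (qbar φ) g + qbar φ g * along T (pbar φ) g)
    - omegabar φ g * (pbar φ g * along (Y φ) (qbar φ) g + qbar φ g * along (Y φ) (pbar φ) g)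
    - qbar φ g ^ 2 * omegabar φ g ^ 2
    - along (Z φ) (omegabar φ) g
    - pbar φ g * qbar φ g * omegabar φ g * meanCurvature φ g

/-! ### Deformations and the second variation -/

/-- The deformation `g ↦ g + r 𝒳(g)`. -/
def deform (𝒳 : Heis → Heis) (r : ℝ) (g : Heis) : Heis := g + r • 𝒳 g

/-- The `H`-perimeter of the portion of the deformed surface `M + r 𝒳` that comes from `E ⊆ M`,
measured on the deformed surface. -/
def deformedPerimeter (M E : Set Heis) (𝒳 : Heis → Heis) (r : ℝ) : ENNReal :=
  perimeter (deform 𝒳 r '' M) (deform 𝒳 r '' E)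

/-- The second variation: the second derivative of the `H`-perimeter at `r = 0`. For fields with
compact support in `E` the part of the surface outside `E` does not move. -/
def secondVariation (M E : Set Heis) (𝒳 : Heis → Heis) : ℝ :=
  iteratedDeriv 2 (fun r => (deformedPerimeter M E 𝒳 r).toReal) 0

end Heisenberg

end

open Heisenberg

/-!
In a parametrized piece of the surface the horizontal part of the normal is `c • (pbar, qbar)`, and
for the piece deformed by `r a X₁` it becomes `c • (pbar, qbar + r B + r² C)` with the same factor
`c`, where `B = Z a + a omegabar` and `C` is `a` times a first derivative of `a`. Hence the
perimeter of the deformed portion is the integral of `√(pbar² + (qbar + r B + r² C)²)` against the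
`H`-perimeter of the undeformed surface, and since `pbar² + qbar² = 1` one may differentiate twice
under the integral sign at `r = 0`, which gives the integrand `pbar² B² + 2 qbar C`.

This differs from the claimed integrand by the exterior derivative on the surface of a compactly
supported one-form, `a²` times a form that depends only on the surface. By Stokes' theorem, applied
in charts with a partition of unity, the difference integrates to zero.
-/

noncomputable section

open scoped ContDiff Manifold

namespace Heisenberg

/-! ### Calculus and measures -/

section Calculus

variable {E F : Type*} [NormedAddCommGroup E] [NormedSpace ℝ E]
  [NormedAddCommGroup F] [NormedSpace ℝ F]

lemma contDiff_indicator {n : WithTop ℕ∞} {U K : Set E} {f : E → F} (hU : IsOpen U)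
    (hK : IsClosed K) (hKU : K ⊆ U) (hf : ContDiffOn ℝ n f U) (h0 : ∀ x ∈ U \ K, f x = 0) :
    ContDiff ℝ n (U.indicator f) := by
  refine contDiff_iff_contDiffAt.2 fun x => ?_
  by_cases hx : x ∈ U
  · refine (hf.contDiffAt (hU.mem_nhds hx)).congr_of_eventuallyEq ?_
    filter_upwards [hU.mem_nhds hx] with y hy using Set.indicator_of_mem hy f
  · refine contDiffAt_const (c := (0 : F)) |>.congr_of_eventuallyEq ?_
    filter_upwards [hK.isOpen_compl.mem_nhds fun h => hx (hKU h)] with y hy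
    exact Set.indicator_apply_eq_zero.2 fun hyU => h0 y ⟨hyU, hy⟩

lemma fderiv_indicator {U : Set E} (hU : IsOpen U) (f : E → F) {x : E} (hx : x ∈ U) :
    fderiv ℝ (U.indicator f) x = fderiv ℝ f x :=
  Filter.EventuallyEq.fderiv_eq <| by
    filter_upwards [hU.mem_nhds hx] with y hy using Set.indicator_of_mem hy f

lemma exists_fderiv_eq_smul_of_eventuallyEq_zero [CompleteSpace E] {f φ : E → ℝ} {x : E}
    (hf : ContDiffAt ℝ 1 f x) (hφ : ContDiffAt ℝ 1 φ x) (hφ' : fderiv ℝ φ x ≠ 0)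
    (h : f =ᶠ[𝓝[{y | φ y = φ x}] x] 0) : ∃ c : ℝ, fderiv ℝ f x = c • fderiv ℝ φ x := by
  have hextr : IsLocalExtrOn f {y | φ y = φ x} x :=
    .inl <| h.mono fun y hy => ((h.self_of_nhdsWithin rfl).trans hy.symm).le
  obtain ⟨s, t, hst, hsum⟩ := hextr.exists_multipliers_of_hasStrictFDerivAt_1d
    (hφ.hasStrictFDerivAt one_ne_zero) (hf.hasStrictFDerivAt one_ne_zero)
  have ht : t ≠ 0 := by
    rintro rfl
    simp_all
  exact ⟨-(t⁻¹ * s), by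
    rw [neg_smul, mul_smul, eq_neg_of_add_eq_zero_left hsum, smul_neg, inv_smul_smul₀ ht, neg_neg]⟩

section Integral

variable [MeasurableSpace E] [BorelSpace E] (μ : Measure E)

lemma integrable_fderiv_apply [IsFiniteMeasureOnCompacts μ] {f : E → F} (hf : ContDiff ℝ 1 f)
    (hc : HasCompactSupport f) (v : E) : Integrable (fun x => fderiv ℝ f x v) μ :=
  ((hf.continuous_fderiv one_ne_zero).clm_apply
    continuous_const).integrable_of_hasCompactSupport (hc.fderiv_apply (𝕜 := ℝ) v)

lemma integrableOn_fderiv_apply [IsFiniteMeasureOnCompacts μ] {U K : Set E} {f : E → F}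
    (hU : IsOpen U) (hK : IsCompact K) (hKU : K ⊆ U) (hf : ContDiffOn ℝ 1 f U)
    (h0 : ∀ x ∈ U \ K, f x = 0) (v : E) : IntegrableOn (fun x => fderiv ℝ f x v) U μ := by
  have hG := contDiff_indicator hU hK.isClosed hKU hf h0
  have hc : HasCompactSupport (U.indicator f) := HasCompactSupport.intro hK fun x hx =>
    Set.indicator_apply_eq_zero.2 fun hxU => h0 x ⟨hxU, hx⟩
  refine (integrable_fderiv_apply μ hG hc v).integrableOn.congr_fun (fun x hx => ?_)
    hU.measurableSet
  simp only [fderiv_indicator hU f hx]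

variable [FiniteDimensional ℝ E] [μ.IsAddHaarMeasure]

lemma integral_fderiv_apply_eq_zero {f : E → ℝ} (hf : ContDiff ℝ 1 f)
    (hc : HasCompactSupport f) (v : E) : ∫ x, fderiv ℝ f x v ∂μ = 0 := by
  have h := integral_mul_fderiv_eq_neg_fderiv_mul_of_integrable
    (μ := μ) (f := fun _ : E => (1 : ℝ)) (g := f) (v := v) (by simp)
    (by simpa using integrable_fderiv_apply μ hf hc v)
    (by simpa using hf.continuous.integrable_of_hasCompactSupport hc)
    (fun _ _ => differentiableAt_const _) (fun x _ => hf.differentiable one_ne_zero x)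
  simpa using h

lemma setIntegral_fderiv_apply_eq_zero {U K : Set E} {f : E → ℝ} (hU : IsOpen U)
    (hK : IsCompact K) (hKU : K ⊆ U) (hf : ContDiffOn ℝ 1 f U) (h0 : ∀ x ∈ U \ K, f x = 0)
    (v : E) : ∫ x in U, fderiv ℝ f x v ∂μ = 0 := by
  have hG := contDiff_indicator hU hK.isClosed hKU hf h0
  have hzero : ∀ x ∉ K, U.indicator f x = 0 := fun x hx =>
    Set.indicator_apply_eq_zero.2 fun hxU => h0 x ⟨hxU, hx⟩
  have hsub : Function.support (fun x => fderiv ℝ (U.indicator f) x v) ⊆ U := fun x hx => by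
    refine hKU (by_contra fun hxK => hx ?_)
    have : U.indicator f =ᶠ[𝓝 x] fun _ => 0 := by
      filter_upwards [hK.isClosed.isOpen_compl.mem_nhds hxK] with y hy using hzero y hy
    simp [this.fderiv_eq]
  rw [← integral_fderiv_apply_eq_zero μ hG (HasCompactSupport.intro hK hzero) v,
    ← setIntegral_eq_integral_of_forall_compl_eq_zero fun x hx =>
      by_contra fun h => hx (hsub h)]
  exact setIntegral_congr_fun hU.measurableSet fun x hx => by
    simp only [fderiv_indicator hU f hx]

end Integral

lemma exists_finset_partition_of_unity [FiniteDimensional ℝ E] {K : Set E} (hK : IsCompact K)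
    {O : E → Set E} (hO : ∀ x ∈ K, O x ∈ 𝓝 x) :
    ∃ (t : Finset E) (ρ : t → E → ℝ),
      (∀ i : t, (i : E) ∈ K ∧ ContDiff ℝ ∞ (ρ i) ∧ tsupport (ρ i) ⊆ O i) ∧
      ∀ x ∈ K, ∑ i, ρ i x = 1 := by
  obtain ⟨t, htK, ht⟩ := hK.elim_nhds_subcover (fun x => interior (O x))
    fun x hx => interior_mem_nhds.2 (hO x hx)
  obtain ⟨ρ, hρ⟩ := SmoothPartitionOfUnity.exists_isSubordinate 𝓘(ℝ, E) hK.isClosed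
    (fun i : t => interior (O i)) (fun i => isOpen_interior) fun x hx => by
      obtain ⟨i, hi, hxi⟩ := Set.mem_iUnion₂.1 (ht hx)
      exact Set.mem_iUnion.2 ⟨⟨i, hi⟩, hxi⟩
  refine ⟨t, fun i => ρ i, fun i => ⟨htK i i.2, (ρ i).contMDiff.contDiff,
    (hρ i).trans interior_subset⟩, fun x hx => ?_⟩
  rw [← finsum_eq_sum_of_fintype]
  exact ρ.sum_eq_one hx

lemma exists_contDiff_hasCompactSupport_eq_one [FiniteDimensional ℝ E] {K : Set E}
    (hK : IsCompact K) :
    ∃ χ : E → ℝ, ContDiff ℝ ∞ χ ∧ HasCompactSupport χ ∧ ∀ x ∈ K, χ x = 1 := by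
  obtain ⟨K', hK', hKK'⟩ := exists_compact_superset hK
  obtain ⟨χ, hone, hzero, -⟩ := exists_contMDiffMap_one_nhds_of_subset_interior (n := ⊤)
    𝓘(ℝ, E) hK.isClosed hKK'
  exact ⟨χ, χ.contMDiff.contDiff, HasCompactSupport.intro hK' hzero,
    fun x hx => hone.self_of_nhdsSet x hx⟩

end Calculus

section Derivatives

variable {F : Type*} [NormedAddCommGroup F] [NormedSpace ℝ F] {f f' f'' : ℝ → F} {s : Set ℝ}

lemma contDiffOn_two_of_hasDerivAt (hs : IsOpen s) (h : ∀ r ∈ s, HasDerivAt f (f' r) r)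
    (h' : ∀ r ∈ s, HasDerivAt f' (f'' r) r) (hc : ContinuousOn f'' s) : ContDiffOn ℝ 2 f s := by
  have hone : ContDiffOn ℝ (0 + 1) f' s :=
    (contDiffOn_succ_iff_deriv_of_isOpen hs).2
      ⟨fun r hr => (h' r hr).differentiableAt.differentiableWithinAt, by simp,
        contDiffOn_zero.2 (hc.congr fun r hr => (h' r hr).deriv)⟩
  exact (contDiffOn_succ_iff_deriv_of_isOpen (n := 0 + 1) hs).2
    ⟨fun r hr => (h r hr).differentiableAt.differentiableWithinAt, by simp,
      hone.congr fun r hr => (h r hr).deriv⟩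

lemma iteratedDeriv_two_eq_of_hasDerivAt (hs : IsOpen s) (h : ∀ r ∈ s, HasDerivAt f (f' r) r)
    (h' : ∀ r ∈ s, HasDerivAt f' (f'' r) r) {r : ℝ} (hr : r ∈ s) :
    iteratedDeriv 2 f r = f'' r := by
  have : deriv f =ᶠ[𝓝 r] f' := by
    filter_upwards [hs.mem_nhds hr] with q hq using (h q hq).deriv
  rw [iteratedDeriv_succ, iteratedDeriv_one, this.deriv_eq, (h' r hr).deriv]

variable {α : Type*} [MeasurableSpace α] {μ : Measure α} {G G' G'' : ℝ → α → F} {bound : α → ℝ}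

lemma hasDerivAt_integral_of_isOpen (hs : IsOpen s)
    (hm : ∀ r ∈ s, AEStronglyMeasurable (G r) μ) (hm' : ∀ r ∈ s, AEStronglyMeasurable (G' r) μ)
    (hbi : Integrable bound μ) (hb : ∀ᵐ x ∂μ, ∀ r ∈ s, ‖G r x‖ ≤ bound x)
    (hb' : ∀ᵐ x ∂μ, ∀ r ∈ s, ‖G' r x‖ ≤ bound x)
    (hd : ∀ᵐ x ∂μ, ∀ r ∈ s, HasDerivAt (G · x) (G' r x) r) {r : ℝ} (hr : r ∈ s) :
    HasDerivAt (fun r => ∫ x, G r x ∂μ) (∫ x, G' r x ∂μ) r :=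
  (hasDerivAt_integral_of_dominated_loc_of_deriv_le (hs.mem_nhds hr)
    (by filter_upwards [hs.mem_nhds hr] with q hq using hm q hq)
    (hbi.mono' (hm r hr) (hb.mono fun x hx => hx r hr)) (hm' r hr) hb' hbi hd).2

lemma contDiffOn_two_integral (hs : IsOpen s)
    (hm : ∀ r ∈ s, AEStronglyMeasurable (G r) μ) (hm' : ∀ r ∈ s, AEStronglyMeasurable (G' r) μ)
    (hm'' : ∀ r ∈ s, AEStronglyMeasurable (G'' r) μ) (hbi : Integrable bound μ)
    (hb : ∀ᵐ x ∂μ, ∀ r ∈ s, ‖G r x‖ ≤ bound x) (hb' : ∀ᵐ x ∂μ, ∀ r ∈ s, ‖G' r x‖ ≤ bound x)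
    (hb'' : ∀ᵐ x ∂μ, ∀ r ∈ s, ‖G'' r x‖ ≤ bound x)
    (hd : ∀ᵐ x ∂μ, ∀ r ∈ s, HasDerivAt (G · x) (G' r x) r)
    (hd' : ∀ᵐ x ∂μ, ∀ r ∈ s, HasDerivAt (G' · x) (G'' r x) r)
    (hc : ∀ᵐ x ∂μ, ContinuousOn (G'' · x) s) :
    ContDiffOn ℝ 2 (fun r => ∫ x, G r x ∂μ) s ∧
      ∀ r ∈ s, iteratedDeriv 2 (fun r => ∫ x, G r x ∂μ) r = ∫ x, G'' r x ∂μ := by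
  have hderiv := fun r hr => hasDerivAt_integral_of_isOpen hs hm hm' hbi hb hb' hd (r := r) hr
  have hderiv' := fun r hr =>
    hasDerivAt_integral_of_isOpen hs hm' hm'' hbi hb' hb'' hd' (r := r) hr
  refine ⟨contDiffOn_two_of_hasDerivAt hs hderiv hderiv' ?_,
    fun r hr => iteratedDeriv_two_eq_of_hasDerivAt hs hderiv hderiv' hr⟩
  exact continuousOn_of_dominated hm'' (fun r hr => hb''.mono fun x hx => hx r hr) hbi hc

end Derivatives

section Homeomorphisms

variable {E : Type*} [NormedAddCommGroup E] [NormedSpace ℝ E]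

lemma exists_homeomorph_id_add [CompleteSpace E] {n : WithTop ℕ∞} (hn : n ≠ 0) {f : E → E}
    (hf : ContDiff ℝ n f) {c : NNReal} (hc : c < 1) (hlip : LipschitzWith c f) :
    ∃ Φ : E ≃ₜ E, (∀ x, Φ x = x + f x) ∧ ContDiff ℝ n Φ ∧ ContDiff ℝ n Φ.symm := by
  have hadd : ContDiff ℝ n fun x => x + f x := contDiff_id.add hf
  have happrox : ApproximatesLinearOn (fun x => x + f x)
      (ContinuousLinearEquiv.refl ℝ E : E →L[ℝ] E) Set.univ c := fun x _ y _ => by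
    simpa [dist_eq_norm, add_sub_add_comm] using hlip.dist_le_mul x y
  let Φ : E ≃ₜ E := happrox.toHomeomorph _ (by
    rcases subsingleton_or_nontrivial E with hE | hE
    · exact Or.inl hE
    · exact Or.inr (by simpa using hc))
  have hderiv : ∀ x, HasFDerivAt (fun x => x + f x)
      (ContinuousLinearMap.id ℝ E + fderiv ℝ f x) x := fun x =>
    (hasFDerivAt_id x).add (hf.differentiable hn x).hasFDerivAt
  have hnorm : ∀ x, ‖-fderiv ℝ f x‖ < 1 := fun x => by
    rw [norm_neg]
    exact (norm_fderiv_le_of_lipschitz ℝ hlip).trans_lt (by exact_mod_cast hc)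
  let A : E → E ≃L[ℝ] E := fun x => ContinuousLinearEquiv.ofUnit (Units.oneSub _ (hnorm x))
  refine ⟨Φ, fun x => rfl, hadd, Φ.contDiff_symm (f₀' := A) (fun x => ?_) hadd⟩
  refine (hderiv x).congr_fderiv ?_
  ext v
  simp [A, ContinuousLinearEquiv.ofUnit]

variable {F : Type*} [NormedAddCommGroup F] [NormedSpace ℝ F]

lemma exists_openPartialHomeomorph_contDiffOn_symm [CompleteSpace E] {n : WithTop ℕ∞}
    (hn : n ≠ 0) (hn' : n ≠ ∞) {f : E → F} {f' : E ≃L[ℝ] F} {x : E} (hf : ContDiffAt ℝ n f x)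
    (hf' : HasFDerivAt f (f' : E →L[ℝ] F) x) {V : Set E} (hV : V ∈ 𝓝 x) :
    ∃ e : OpenPartialHomeomorph E F, ⇑e = f ∧ x ∈ e.source ∧ e.source ⊆ V ∧
      ContDiffOn ℝ n e.symm e.target := by
  let e := hf.toOpenPartialHomeomorph f hf' hn
  have hx : x ∈ e.source := hf.mem_toOpenPartialHomeomorph_source hf' hn
  have hsymm : ContDiffAt ℝ n e.symm (e x) := hf.to_localInverse hf' hn
  obtain ⟨T', hT', hT'open, hxT'⟩ := eventually_nhds_iff.1 (hsymm.eventually hn')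
  let O := interior V ∩ (e.source ∩ e ⁻¹' T')
  have hO : IsOpen O := isOpen_interior.inter (e.isOpen_inter_preimage hT'open)
  refine ⟨e.restrOpen O hO, rfl, ⟨hx, mem_interior_iff_mem_nhds.2 hV, hx, hxT'⟩,
    fun y hy => interior_subset hy.2.1, fun y hy => ?_⟩
  have hyT' : e (e.symm y) ∈ T' := hy.2.2.2
  rw [e.right_inv hy.1] at hyT'
  exact (hT' y hyT').contDiffWithinAt

lemma exists_continuousLinearEquiv_prod [FiniteDimensional ℝ E] [FiniteDimensional ℝ F]
    (hdim : Module.finrank ℝ E = Module.finrank ℝ F + 1) {L : E →L[ℝ] ℝ} (hL : L ≠ 0) :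
    ∃ A : E ≃L[ℝ] ℝ × F, ∀ v, (A v).1 = L v := by
  obtain ⟨x, hx⟩ : ∃ x, L x ≠ 0 := by
    by_contra! h
    exact hL (ContinuousLinearMap.ext h)
  have hker : Module.finrank ℝ L.ker = Module.finrank ℝ F := by
    have hrange : (L : E →ₗ[ℝ] ℝ).range = ⊤ :=
      LinearMap.range_eq_top.2 (LinearMap.surjective fun h => hx (congrArg (· x) h))
    have := (L : E →ₗ[ℝ] ℝ).finrank_range_add_finrank_ker
    rw [hrange, finrank_top, Module.finrank_self, hdim] at this
    exact Nat.add_left_cancel (this.trans (add_comm _ _))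
  let e : L.ker ≃ₗ[ℝ] F := LinearEquiv.ofFinrankEq _ _ hker
  let p : E →ₗ[ℝ] L.ker := (LinearMap.id - ((L x)⁻¹ • (L : E →ₗ[ℝ] ℝ)).smulRight x).codRestrict
    L.ker fun v => by
      simp [mul_right_comm _ (L v), inv_mul_cancel₀ hx]
  let A : E →ₗ[ℝ] ℝ × F := (L : E →ₗ[ℝ] ℝ).prod (e.toLinearMap ∘ₗ p)
  have hinj : Function.Injective A := (injective_iff_map_eq_zero A).2 fun v hv => by
    obtain ⟨hLv, hpv⟩ := Prod.mk_eq_zero.1 (show (L v, e (p v)) = 0 from hv)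
    have hpv' : v - ((L x)⁻¹ * L v) • x = 0 :=
      congrArg Subtype.val (e.map_eq_zero_iff.1 hpv)
    simpa [hLv] using hpv'
  have hfin : Module.finrank ℝ E = Module.finrank ℝ (ℝ × F) := by
    rw [hdim, Module.finrank_prod, Module.finrank_self, add_comm]
  exact ⟨(LinearEquiv.ofInjectiveOfFinrankEq A hinj hfin).toContinuousLinearEquiv, fun v => rfl⟩

end Homeomorphisms

section Measures

variable {α β : Type*} [MeasurableSpace α] [MeasurableSpace β]

lemma measurableSet_inter_preimage_of_continuousOn [TopologicalSpace α] [OpensMeasurableSpace α]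
    [TopologicalSpace β] [BorelSpace β] {U : Set α} {f : α → β} (hf : ContinuousOn f U)
    (hU : MeasurableSet U) {A : Set β} (hA : MeasurableSet A) : MeasurableSet (U ∩ f ⁻¹' A) := by
  rw [← Subtype.image_preimage_coe]
  exact hU.subtype_image ((continuousOn_iff_continuous_domRestrict.1 hf).measurable hA)

lemma withDensity_mono_left {μ ν : Measure α} (h : μ ≤ ν) (f : α → ENNReal) :
    μ.withDensity f ≤ ν.withDensity f :=
  Measure.le_iff.2 fun s hs => by
    rw [withDensity_apply f hs, withDensity_apply f hs]
    exact lintegral_mono' (Measure.restrict_mono le_rfl h) le_rfl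

/-- The order isomorphism `μ ↦ e_* (f μ)` between the measures on two spaces. It transports the
suprema of families of measures by which the perimeter is defined. -/
def mapWithDensity (e : α ≃ᵐ β) {f : α → ENNReal} (hf : Measurable f) (hf0 : ∀ x, f x ≠ 0)
    (hftop : ∀ x, f x ≠ ⊤) : Measure α ≃o Measure β :=
  have hleft (μ : Measure α) :
      (((μ.withDensity f).map e).map e.symm).withDensity f⁻¹ = μ := by
    rw [e.map_symm_map]
    exact withDensity_inv_same hf (ae_of_all _ hf0) (ae_of_all _ hftop)
  { toFun := fun μ => (μ.withDensity f).map e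
    invFun := fun ν => (ν.map e.symm).withDensity f⁻¹
    left_inv := hleft
    right_inv := fun ν => by
      have hinv := withDensity_inv_same (μ := ν.map e.symm) hf.inv
        (ae_of_all _ fun x => ENNReal.inv_ne_zero.2 (hftop x))
        (ae_of_all _ fun x => ENNReal.inv_ne_top.2 (hf0 x))
      simp only [Pi.inv_apply, inv_inv] at hinv
      exact (congrArg (Measure.map e) hinv).trans e.map_map_symm
    map_rel_iff' := fun {μ ν} =>
      ⟨fun h => hleft μ ▸ hleft ν ▸
        withDensity_mono_left (Measure.map_mono h e.symm.measurable) f⁻¹,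
      fun h => Measure.map_mono (withDensity_mono_left h f) e.measurable⟩ }

end Measures

/-! ### The length of the deformed normal -/

section NormalLength

/-- The length `√(P² + (Q + r B + r² C)²)`. If `(P, Q)` is the horizontal normal of the surface,
then `(P, Q + r B + r² C)` is that of the surface deformed along `a X₁`. -/
def normalLength (P Q B C r : ℝ) : ℝ := √(P ^ 2 + (Q + r * B + r ^ 2 * C) ^ 2)

/-- The derivative of `normalLength P Q B C`. -/
def normalLengthDeriv (P Q B C r : ℝ) : ℝ :=
  (Q + r * B + r ^ 2 * C) * (B + 2 * r * C) / normalLength P Q B C r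

/-- The second derivative of `normalLength P Q B C`. -/
def normalLengthDeriv2 (P Q B C r : ℝ) : ℝ :=
  ((B + 2 * r * C) ^ 2 + (Q + r * B + r ^ 2 * C) * (2 * C)) / normalLength P Q B C r -
    ((Q + r * B + r ^ 2 * C) * (B + 2 * r * C)) ^ 2 / normalLength P Q B C r ^ 3

variable {P Q B C M r : ℝ}

lemma hasDerivAt_quadratic : HasDerivAt (fun r => Q + r * B + r ^ 2 * C) (B + 2 * r * C) r :=
  ((((hasDerivAt_id r).mul_const B).const_add Q).add
    (((hasDerivAt_id r).pow 2).mul_const C)).congr_deriv (by simp)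

lemma hasDerivAt_normalLength (h : 0 < normalLength P Q B C r) :
    HasDerivAt (normalLength P Q B C) (normalLengthDeriv P Q B C r) r := by
  have := ((hasDerivAt_quadratic.pow 2).const_add (P ^ 2)).sqrt (Real.sqrt_pos.1 h).ne'
  refine this.congr_deriv ?_
  simp only [normalLengthDeriv, normalLength, Pi.pow_apply, Nat.cast_ofNat, Nat.add_one_sub_one,
    pow_one]
  rw [mul_assoc, mul_div_mul_left _ _ two_ne_zero]

lemma hasDerivAt_normalLengthDeriv (h : 0 < normalLength P Q B C r) :
    HasDerivAt (normalLengthDeriv P Q B C) (normalLengthDeriv2 P Q B C r) r := by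
  have hlin : HasDerivAt (fun r : ℝ => B + 2 * r * C) (2 * C) r :=
    ((((hasDerivAt_id r).const_mul 2).mul_const C).const_add B).congr_deriv (by simp)
  refine ((hasDerivAt_quadratic.mul hlin).div (hasDerivAt_normalLength h) h.ne').congr_deriv ?_
  simp only [normalLengthDeriv2, normalLengthDeriv, Pi.mul_apply]
  field_simp [h.ne']

lemma normalLengthDeriv2_zero (h : P ^ 2 + Q ^ 2 = 1) :
    normalLengthDeriv2 P Q B C 0 = P ^ 2 * B ^ 2 + 2 * Q * C := by
  simp only [normalLengthDeriv2, normalLength, zero_mul, mul_zero, add_zero, ne_eq,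
    OfNat.ofNat_ne_zero, not_false_eq_true, zero_pow, h, Real.sqrt_one, one_pow, div_one]
  linear_combination -B ^ 2 * h

/-- The coefficients `(P, Q, B, C)` of `normalLength` for which `(P, Q)` is a unit vector and `B`,
`C` are bounded by `M`: on this compact set `normalLength` and its derivatives are bounded near
`r = 0`. -/
def unitCoefficients (M : ℝ) : Set (ℝ × ℝ × ℝ × ℝ) :=
  {c | c.1 ^ 2 + c.2.1 ^ 2 = 1 ∧ |c.2.2.1| ≤ M ∧ |c.2.2.2| ≤ M}

lemma isCompact_unitCoefficients : IsCompact (unitCoefficients M) := by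
  refine Metric.isCompact_of_isClosed_isBounded ?_ ?_
  · simp only [unitCoefficients, Set.ofPred_and]
    exact (isClosed_eq (by fun_prop) continuous_const).inter
      ((isClosed_le (by fun_prop) continuous_const).inter
        (isClosed_le (by fun_prop) continuous_const))
  · refine isBounded_iff_forall_norm_le.2 ⟨max 1 M, fun c ⟨hPQ, hB, hC⟩ => ?_⟩
    simp only [Prod.norm_def, Real.norm_eq_abs, sup_le_iff]
    exact ⟨le_max_of_le_left (abs_le_one_iff_mul_self_le_one.2 (by nlinarith [sq_nonneg c.2.1])),
      le_max_of_le_left (abs_le_one_iff_mul_self_le_one.2 (by nlinarith [sq_nonneg c.1])),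
      le_max_of_le_right hB, le_max_of_le_right hC⟩

lemma normalLength_pos (h : (P, Q, B, C) ∈ unitCoefficients M) (hr : |r| * (2 * (M + 1)) ≤ 1) :
    0 < normalLength P Q B C r := by
  obtain ⟨hPQ, hB, hC⟩ := h
  have hM : 0 ≤ M := (abs_nonneg B).trans hB
  have hr1 : |r| ≤ 1 := by nlinarith [abs_nonneg r]
  have hsmall : |r * B + r ^ 2 * C| < 1 :=
    calc |r * B + r ^ 2 * C| ≤ |r * B| + |r ^ 2 * C| := abs_add_le _ _
      _ = |r| * |B| + |r| * (|r| * |C|) := by simp only [abs_mul, abs_pow]; ring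
      _ ≤ |r| * M + |r| * (1 * M) := by gcongr
      _ < 1 := by nlinarith [abs_nonneg r]
  refine Real.sqrt_pos.2 ((by positivity : (0 : ℝ) ≤ _).lt_of_ne' fun h0 => ?_)
  have hP : P = 0 := by nlinarith [sq_nonneg P, sq_nonneg (Q + r * B + r ^ 2 * C)]
  have hQ : Q = -(r * B + r ^ 2 * C) := by
    nlinarith [sq_nonneg P, sq_nonneg (Q + r * B + r ^ 2 * C)]
  have : |r * B + r ^ 2 * C| ^ 2 = 1 := by rw [sq_abs, ← neg_sq, ← hQ, ← hPQ, hP]; ring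
  nlinarith [abs_nonneg (r * B + r ^ 2 * C)]

lemma exists_normalLength_bound (hM : 0 ≤ M) :
    ∃ δ > 0, ∃ D, ∀ P Q B C, (P, Q, B, C) ∈ unitCoefficients M → ∀ r ∈ Set.Ioo (-δ) δ,
      0 < normalLength P Q B C r ∧ |normalLength P Q B C r| ≤ D ∧
        |normalLengthDeriv P Q B C r| ≤ D ∧ |normalLengthDeriv2 P Q B C r| ≤ D := by
  let δ := (2 * (M + 1))⁻¹
  have hpos : ∀ x ∈ unitCoefficients M ×ˢ Set.Icc (-δ) δ,
      0 < normalLength x.1.1 x.1.2.1 x.1.2.2.1 x.1.2.2.2 x.2 := fun x hx =>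
    normalLength_pos hx.1 ((le_inv_mul_iff₀' (by positivity)).1 (by
      simpa [δ] using abs_le.2 ⟨hx.2.1, hx.2.2⟩))
  have hcompact : IsCompact (unitCoefficients M ×ˢ Set.Icc (-δ) δ) :=
    isCompact_unitCoefficients.prod isCompact_Icc
  have hcont : Continuous fun x : (ℝ × ℝ × ℝ × ℝ) × ℝ =>
      normalLength x.1.1 x.1.2.1 x.1.2.2.1 x.1.2.2.2 x.2 := by unfold normalLength; fun_prop
  obtain ⟨D₀, hD₀⟩ := hcompact.exists_bound_of_continuousOn hcont.continuousOn
  obtain ⟨D₁, hD₁⟩ := hcompact.exists_bound_of_continuousOn (f := fun x =>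
      normalLengthDeriv x.1.1 x.1.2.1 x.1.2.2.1 x.1.2.2.2 x.2) <|
    .div (by fun_prop) hcont.continuousOn fun x hx => (hpos x hx).ne'
  obtain ⟨D₂, hD₂⟩ := hcompact.exists_bound_of_continuousOn (f := fun x =>
      normalLengthDeriv2 x.1.1 x.1.2.1 x.1.2.2.1 x.1.2.2.2 x.2) <|
    .sub (.div (by fun_prop) hcont.continuousOn fun x hx => (hpos x hx).ne') <|
      .div (by fun_prop) (hcont.pow 3).continuousOn fun x hx => (pow_pos (hpos x hx) 3).ne'
  refine ⟨δ, by positivity, max D₀ (max D₁ D₂), fun P Q B C hc r hr => ?_⟩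
  have hx : ((P, Q, B, C), r) ∈ unitCoefficients M ×ˢ Set.Icc (-δ) δ :=
    ⟨hc, Set.Ioo_subset_Icc_self hr⟩
  exact ⟨hpos _ hx, le_max_of_le_left (hD₀ _ hx),
    le_max_of_le_right (le_max_of_le_left (hD₁ _ hx)),
    le_max_of_le_right (le_max_of_le_right (hD₂ _ hx))⟩

lemma contDiffAt_integral_normalLength {α : Type*} [MeasurableSpace α] {μ : Measure α}
    [IsFiniteMeasure μ] {P Q B C : α → ℝ} (hP : AEMeasurable P μ) (hQ : AEMeasurable Q μ)
    (hB : AEMeasurable B μ) (hC : AEMeasurable C μ) (hM : 0 ≤ M)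
    (h : ∀ᵐ x ∂μ, (P x, Q x, B x, C x) ∈ unitCoefficients M) :
    ContDiffAt ℝ 2 (fun r => ∫ x, normalLength (P x) (Q x) (B x) (C x) r ∂μ) 0 ∧
      iteratedDeriv 2 (fun r => ∫ x, normalLength (P x) (Q x) (B x) (C x) r ∂μ) 0 =
        ∫ x, (P x ^ 2 * B x ^ 2 + 2 * Q x * C x) ∂μ := by
  obtain ⟨δ, hδ, D, hD⟩ := exists_normalLength_bound hM
  have h0 : (0 : ℝ) ∈ Set.Ioo (-δ) δ := ⟨neg_lt_zero.2 hδ, hδ⟩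
  have hbound := h.mono fun x hx => hD _ _ _ _ hx
  obtain ⟨hcd, hderiv⟩ := contDiffOn_two_integral isOpen_Ioo (μ := μ)
    (G := fun r x => normalLength (P x) (Q x) (B x) (C x) r)
    (G' := fun r x => normalLengthDeriv (P x) (Q x) (B x) (C x) r)
    (G'' := fun r x => normalLengthDeriv2 (P x) (Q x) (B x) (C x) r)
    (fun r _ => AEMeasurable.aestronglyMeasurable (by unfold normalLength; fun_prop))
    (fun r _ => AEMeasurable.aestronglyMeasurable (by
      unfold normalLengthDeriv normalLength; fun_prop))
    (fun r _ => AEMeasurable.aestronglyMeasurable (by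
      unfold normalLengthDeriv2 normalLength; fun_prop))
    (integrable_const D) (hbound.mono fun x hx r hr => (hx r hr).2.1)
    (hbound.mono fun x hx r hr => (hx r hr).2.2.1) (hbound.mono fun x hx r hr => (hx r hr).2.2.2)
    (hbound.mono fun x hx r hr => hasDerivAt_normalLength (hx r hr).1)
    (hbound.mono fun x hx r hr => hasDerivAt_normalLengthDeriv (hx r hr).1)
    (hbound.mono fun x hx => by
      have hcont : Continuous (normalLength (P x) (Q x) (B x) (C x)) := by
        unfold normalLength; fun_prop
      exact .sub (.div (by fun_prop) hcont.continuousOn fun r hr => (hx r hr).1.ne') <|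
        .div (by fun_prop) (hcont.pow 3).continuousOn fun r hr => (pow_pos (hx r hr).1 3).ne')
  refine ⟨hcd.contDiffAt (isOpen_Ioo.mem_nhds h0), (hderiv 0 h0).trans (integral_congr_ae ?_)⟩
  filter_upwards [h] with x hx using normalLengthDeriv2_zero hx.1

end NormalLength

/-! ### Normals and perimeter in a parametrization -/

section Normals

variable {φ f : Heis → ℝ} {g : Heis} {θ θ' : ℝ × ℝ → Heis} {ψ : ℝ × ℝ → ℝ × ℝ} {u : ℝ × ℝ}

lemma fderiv_apply_eq_dotProduct (f : Heis → ℝ) (g v : Heis) :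
    fderiv ℝ f g v = rgrad f g ⬝ᵥ frameCoord g v := by
  conv_lhs => rw [← frameCoord_spec g v]
  simp only [map_add, map_smul, smul_eq_mul, rgrad, along, vec3_dotProduct, cons_val_zero,
    cons_val_one, cons_val, mul_comm]

/-- The frame coordinates at `g`, as a linear map. -/
def frameLinear (g : Heis) : Heis →ₗ[ℝ] (Fin 3 → ℝ) where
  toFun := frameCoord g
  map_add' v w := by
    ext i
    fin_cases i <;> simp only [frameCoord, Prod.fst_add, Prod.snd_add, Pi.add_apply, Fin.zero_eta,
      Fin.mk_one, Fin.reduceFinMk, cons_val_zero, cons_val_one, cons_val]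
    ring
  map_smul' c v := by
    ext i
    fin_cases i <;> simp only [frameCoord, Prod.smul_fst, Prod.smul_snd, Pi.smul_apply, smul_eq_mul,
      Real.ringHom_apply, Fin.zero_eta, Fin.mk_one, Fin.reduceFinMk, cons_val_zero, cons_val_one,
      cons_val]
    ring

lemma frameLinear_injective (g : Heis) : Function.Injective (frameLinear g) := fun v w h => by
  have h : frameCoord g v = frameCoord g w := h
  rw [← frameCoord_spec g v, ← frameCoord_spec g w, h]

lemma patchNormal_ne_zero (h : Function.Injective (fderiv ℝ θ u)) : patchNormal θ u ≠ 0 := by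
  rw [patchNormal, crossProduct_ne_zero_iff_linearIndependent]
  have hbasis : LinearIndependent ℝ ![((1, 0) : ℝ × ℝ), (0, 1)] :=
    LinearIndependent.pair_iff.2 fun s t hst => by simpa [Prod.ext_iff] using hst
  have hframe : ![frameCoord (θ u) (fderiv ℝ θ u (1, 0)), frameCoord (θ u) (fderiv ℝ θ u (0, 1))] =
      (frameLinear (θ u)).comp (fderiv ℝ θ u : ℝ × ℝ →ₗ[ℝ] Heis) ∘ ![((1, 0) : ℝ × ℝ), (0, 1)] := by
    ext i j
    fin_cases i <;> rfl
  rw [hframe]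
  exact hbasis.map' _ (LinearMap.ker_eq_bot.2 ((frameLinear_injective _).comp h))

lemma exists_cross_eq_smul {n a b : Fin 3 → ℝ} (hn : n ≠ 0) (ha : n ⬝ᵥ a = 0)
    (hb : n ⬝ᵥ b = 0) : ∃ c : ℝ, a ⨯₃ b = c • n := by
  by_contra! h
  refine crossProduct_ne_zero_iff_linearIndependent.2
    ((LinearIndependent.pair_iff' hn).2 fun c => (h c).symm) ?_
  rw [cross_cross_eq_smul_sub_smul', hb, dotProduct_comm, ha, zero_smul, zero_smul, sub_zero]

lemma exists_patchNormal_eq_smul_rgrad (hθ : DifferentiableAt ℝ θ u)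
    (hf : DifferentiableAt ℝ f (θ u)) (hn : rgrad f (θ u) ≠ 0)
    (h0 : ∀ᶠ w in 𝓝 u, f (θ w) = 0) : ∃ c : ℝ, patchNormal θ u = c • rgrad f (θ u) := by
  have horth : ∀ v, rgrad f (θ u) ⬝ᵥ frameCoord (θ u) (fderiv ℝ θ u v) = 0 := fun v => by
    have hcomp : fderiv ℝ (f ∘ θ) u = 0 :=
      (show f ∘ θ =ᶠ[𝓝 u] fun _ => 0 from h0).fderiv_eq.trans (fderiv_const_apply 0)
    rw [← fderiv_apply_eq_dotProduct, ← ContinuousLinearMap.comp_apply, ← fderiv_comp u hf hθ,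
      hcomp, _root_.zero_apply]
  exact exists_cross_eq_smul hn (horth _) (horth _)

lemma det_prod_eq (A : ℝ × ℝ →L[ℝ] ℝ × ℝ) :
    A.det = (A (1, 0)).1 * (A (0, 1)).2 - (A (0, 1)).1 * (A (1, 0)).2 := by
  rw [ContinuousLinearMap.det, ← LinearMap.det_toMatrix (Module.Basis.finTwoProd ℝ),
    Matrix.det_fin_two]
  simp [LinearMap.toMatrix_apply]

lemma patchNormal_comp (hθ : DifferentiableAt ℝ θ (ψ u)) (hψ : DifferentiableAt ℝ ψ u)
    (h : θ' =ᶠ[𝓝 u] θ ∘ ψ) :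
    patchNormal θ' u = (fderiv ℝ ψ u).det • patchNormal θ (ψ u) := by
  have hcoord : ∀ v, frameCoord (θ' u) (fderiv ℝ θ' u v) =
      (fderiv ℝ ψ u v).1 • frameCoord (θ (ψ u)) (fderiv ℝ θ (ψ u) (1, 0)) +
      (fderiv ℝ ψ u v).2 • frameCoord (θ (ψ u)) (fderiv ℝ θ (ψ u) (0, 1)) := fun v => by
    have hv : fderiv ℝ ψ u v = (fderiv ℝ ψ u v).1 • ((1, 0) : ℝ × ℝ) +
        (fderiv ℝ ψ u v).2 • ((0, 1) : ℝ × ℝ) := by ext <;> simp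
    rw [h.fderiv_eq, fderiv_comp u hθ hψ, ContinuousLinearMap.comp_apply, h.self_of_nhds]
    conv_lhs => rw [hv, map_add, map_smul, map_smul]
    exact (frameLinear (θ (ψ u))).map_add _ _ |>.trans <| congrArg₂ _
      ((frameLinear (θ (ψ u))).map_smul _ _) ((frameLinear (θ (ψ u))).map_smul _ _)
  rw [patchNormal, hcoord, hcoord, det_prod_eq, patchNormal]
  ext i
  fin_cases i <;> simp [cross_apply] <;> ring

/-- The density of the horizontal perimeter in a parametrization. -/
def density (θ : ℝ × ℝ → Heis) (u : ℝ × ℝ) : ℝ :=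
  √(patchNormal θ u 0 ^ 2 + patchNormal θ u 1 ^ 2)

lemma density_comp (hθ : DifferentiableAt ℝ θ (ψ u)) (hψ : DifferentiableAt ℝ ψ u)
    (h : θ' =ᶠ[𝓝 u] θ ∘ ψ) :
    density θ' u = |(fderiv ℝ ψ u).det| * density θ (ψ u) := by
  rw [density, patchNormal_comp hθ hψ h, density, ← Real.sqrt_sq_eq_abs,
    ← Real.sqrt_mul (sq_nonneg _)]
  simp only [Pi.smul_apply, smul_eq_mul]
  ring_nf

/-- The vector `ν_H + ω̄ T` in the orthonormal frame: the normal of the level sets of `φ`, scaled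
so that its horizontal part has length one. -/
def hnormal (φ : Heis → ℝ) (g : Heis) : Fin 3 → ℝ := ![pbar φ g, qbar φ g, omegabar φ g]

lemma rgrad_eq_smul_hnormal (hW : W φ g ≠ 0) : rgrad φ g = W φ g • hnormal φ g := by
  ext i
  fin_cases i <;> simp [rgrad, hnormal, pbar, qbar, omegabar, mul_div_cancel₀ _ hW]

lemma W_sq : W φ g ^ 2 = along X1 φ g ^ 2 + along X2 φ g ^ 2 := Real.sq_sqrt (by positivity)

lemma pbar_sq_add_qbar_sq (hW : W φ g ≠ 0) : pbar φ g ^ 2 + qbar φ g ^ 2 = 1 := by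
  rw [pbar, qbar, div_pow, div_pow, ← add_div, ← W_sq, div_self (pow_ne_zero 2 hW)]

lemma density_eq_abs (hW : W φ (θ u) ≠ 0) {c : ℝ} (h : patchNormal θ u = c • hnormal φ (θ u)) :
    density θ u = |c| := by
  rw [density, h, ← Real.sqrt_sq_eq_abs, ← mul_one (c ^ 2), ← pbar_sq_add_qbar_sq hW, mul_add,
    ← mul_pow, ← mul_pow]
  rfl

lemma fderiv_apply_Z :
    fderiv ℝ f g (Z φ g) = qbar φ g * along X1 f g - pbar φ g * along X2 f g := by
  simp [Z, along]

lemma tangentialGradSq_eq_sq (hW : W φ g ≠ 0) :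
    tangentialGradSq φ f g = fderiv ℝ f g (Z φ g) ^ 2 := by
  rw [tangentialGradSq, fderiv_apply_Z]
  linear_combination ((along X1 f g * pbar φ g + along X2 f g * qbar φ g) ^ 2 -
    along X1 f g ^ 2 - along X2 f g ^ 2) * pbar_sq_add_qbar_sq hW

end Normals

section Deformations

variable {φ a : Heis → ℝ} {g : Heis} {r : ℝ}

lemma fderiv_deform_apply (ha : DifferentiableAt ℝ a g) (r : ℝ) (v : Heis) :
    fderiv ℝ (deform (fun g => a g • X1 g) r) g v =
      v + r • (fderiv ℝ a g v • X1 g + a g • ((0, 0, -(v.2.1 / 2)) : Heis)) := by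
  have hX : HasFDerivAt X1 ((0 : Heis →L[ℝ] ℝ).prod ((0 : Heis →L[ℝ] ℝ).prod
      (-((1 / 2 : ℝ) • (ContinuousLinearMap.fst ℝ ℝ ℝ).comp
        (ContinuousLinearMap.snd ℝ ℝ (ℝ × ℝ)))))) g := by
    refine (hasFDerivAt_const _ _).prodMk ((hasFDerivAt_const _ _).prodMk ?_)
    refine (((ContinuousLinearMap.fst ℝ ℝ ℝ).comp (ContinuousLinearMap.snd ℝ ℝ (ℝ × ℝ))
      ).hasFDerivAt.const_smul (1 / 2 : ℝ)).neg.congr_of_eventuallyEq (.of_forall fun h => ?_)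
    simp [div_eq_inv_mul]
  have hderiv : HasFDerivAt (deform (fun g => a g • X1 g) r) _ g :=
    (hasFDerivAt_id g).add ((ha.hasFDerivAt.smul hX).const_smul r)
  rw [hderiv.fderiv]
  simp [add_comm, div_eq_inv_mul]

lemma frameCoord_deform (ha : DifferentiableAt ℝ a g) (r : ℝ) (v : Heis) :
    frameCoord (deform (fun g => a g • X1 g) r g)
      (fderiv ℝ (deform (fun g => a g • X1 g) r) g v) =
      ![frameCoord g v 0 + r * (rgrad a g ⬝ᵥ frameCoord g v),
        frameCoord g v 1, frameCoord g v 2 - r * a g * frameCoord g v 1] := by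
  rw [fderiv_deform_apply ha, ← fderiv_apply_eq_dotProduct a g v]
  ext i
  fin_cases i <;> simp only [frameCoord, deform, X1, Prod.smul_mk, smul_eq_mul, mul_one, mul_zero,
    mul_neg, Prod.mk_add_mk, add_zero, Prod.fst_add, Prod.snd_add, Fin.zero_eta, Fin.mk_one,
    Fin.reduceFinMk, cons_val_zero, cons_val_one, cons_val]
  ring

/-- The coefficient of `r` in the deformed normal. -/
def normalB (φ a : Heis → ℝ) (g : Heis) : ℝ := fderiv ℝ a g (Z φ g) + a g * omegabar φ g

/-- The coefficient of `r²` in the deformed normal. -/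
def normalC (φ a : Heis → ℝ) (g : Heis) : ℝ :=
  a g * (omegabar φ g * along X1 a g - pbar φ g * along T a g)

/-- The factor by which the deformation along `a X₁` multiplies the horizontal perimeter. -/
def jacobian (φ a : Heis → ℝ) (r : ℝ) (g : Heis) : ℝ :=
  normalLength (pbar φ g) (qbar φ g) (normalB φ a g) (normalC φ a g) r

lemma jacobian_nonneg (φ a : Heis → ℝ) (r : ℝ) (g : Heis) : 0 ≤ jacobian φ a r g :=
  Real.sqrt_nonneg _

lemma patchNormal_deform {θ : ℝ × ℝ → Heis} {u : ℝ × ℝ} (ha : DifferentiableAt ℝ a (θ u))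
    (hθ : DifferentiableAt ℝ θ u) {c : ℝ} (hN : patchNormal θ u = c • hnormal φ (θ u)) :
    patchNormal (deform (fun g => a g • X1 g) r ∘ θ) u 0 = c * pbar φ (θ u) ∧
    patchNormal (deform (fun g => a g • X1 g) r ∘ θ) u 1 =
      c * (qbar φ (θ u) + r * normalB φ a (θ u) + r ^ 2 * normalC φ a (θ u)) := by
  have hdeform : DifferentiableAt ℝ (deform (fun g => a g • X1 g) r) (θ u) := by
    unfold deform X1; fun_prop
  have hN0 := congrFun hN 0
  have hN1 := congrFun hN 1
  have hN2 := congrFun hN 2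
  rw [patchNormal, cross_apply] at hN0 hN1 hN2
  simp only [hnormal, Pi.smul_apply, smul_eq_mul, cons_val_zero, cons_val_one, cons_val]
    at hN0 hN1 hN2
  rw [patchNormal, fderiv_comp u hdeform hθ, ContinuousLinearMap.comp_apply,
    ContinuousLinearMap.comp_apply, Function.comp_apply, frameCoord_deform ha,
    frameCoord_deform ha, cross_apply]
  simp only [vec3_dotProduct, rgrad, cons_val_zero, cons_val_one, cons_val, normalB, normalC,
    fderiv_apply_Z]
  constructor
  · linear_combination hN0
  · linear_combination (1 + r * along X1 a (θ u)) * hN1 - (r * along X2 a (θ u) +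
      r ^ 2 * a (θ u) * along T a (θ u)) * hN0 + (r * a (θ u) +
      r ^ 2 * a (θ u) * along X1 a (θ u)) * hN2

lemma density_deform {θ : ℝ × ℝ → Heis} {u : ℝ × ℝ} (ha : DifferentiableAt ℝ a (θ u))
    (hθ : DifferentiableAt ℝ θ u) (hW : W φ (θ u) ≠ 0) {c : ℝ}
    (hN : patchNormal θ u = c • hnormal φ (θ u)) :
    density (deform (fun g => a g • X1 g) r ∘ θ) u = jacobian φ a r (θ u) * density θ u := by
  obtain ⟨hN0, hN1⟩ := patchNormal_deform (r := r) ha hθ hN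
  rw [density, hN0, hN1, mul_pow, mul_pow, ← mul_add, Real.sqrt_mul (sq_nonneg c),
    Real.sqrt_sq_eq_abs, density_eq_abs hW hN, mul_comm]
  rfl

end Deformations

section Perimeter

variable {M O : Set Heis} {U U' : Set (ℝ × ℝ)} {θ θ' : ℝ × ℝ → Heis} {π : Heis → ℝ × ℝ}

lemma IsPatch.differentiableAt (h : IsPatch M U θ) {u : ℝ × ℝ} (hu : u ∈ U) :
    DifferentiableAt ℝ θ u :=
  (h.contDiffOn.contDiffAt (h.isOpen.mem_nhds hu)).differentiableAt one_ne_zero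

lemma IsPatch.continuousOn (h : IsPatch M U θ) : ContinuousOn θ U := h.contDiffOn.continuousOn

lemma continuousOn_frameCoord_fderiv (hU : IsOpen U) (h : ContDiffOn ℝ 1 θ U) (v : ℝ × ℝ) :
    ContinuousOn (fun u => frameCoord (θ u) (fderiv ℝ θ u v)) U := by
  have hθ := h.continuousOn
  have hderiv : ContinuousOn (fun u => fderiv ℝ θ u v) U :=
    (h.continuousOn_fderiv_of_isOpen hU le_rfl).clm_apply continuousOn_const
  unfold frameCoord
  fun_prop

lemma continuousOn_density (hU : IsOpen U) (h : ContDiffOn ℝ 1 θ U) :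
    ContinuousOn (density θ) U := by
  have hframe := fun v i => continuousOn_pi.1 (continuousOn_frameCoord_fderiv hU h v) i
  unfold density patchNormal
  simp only [cross_apply, cons_val_zero, cons_val_one]
  fun_prop

lemma density_nonneg (θ : ℝ × ℝ → Heis) (u : ℝ × ℝ) : 0 ≤ density θ u := Real.sqrt_nonneg _

lemma aemeasurable_density (hU : IsOpen U) (h : ContDiffOn ℝ 1 θ U) :
    AEMeasurable (fun u => ENNReal.ofReal (density θ u)) (volume.restrict U) :=
  ((continuousOn_density hU h).aemeasurable hU.measurableSet).ennreal_ofReal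

lemma patchPerimeter_eq (U : Set (ℝ × ℝ)) (θ : ℝ × ℝ → Heis) :
    patchPerimeter U θ = Measure.map θ ((volume.restrict U).withDensity fun u =>
      ENNReal.ofReal (density θ u)) := rfl

lemma aemeasurable_withDensity (hU : IsOpen U) (h : ContinuousOn θ U) (d : ℝ × ℝ → ENNReal) :
    AEMeasurable θ ((volume.restrict U).withDensity d) :=
  (h.aemeasurable hU.measurableSet).mono_ac (withDensity_absolutelyContinuous _ _)

lemma patchPerimeter_apply (hU : IsOpen U) (h : ContinuousOn θ U) {A : Set Heis}
    (hA : MeasurableSet A) :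
    patchPerimeter U θ A = ∫⁻ u in U ∩ θ ⁻¹' A, ENNReal.ofReal (density θ u) := by
  rw [patchPerimeter_eq, Measure.map_apply_of_aemeasurable (aemeasurable_withDensity hU h _) hA,
    withDensity_apply', Measure.restrict_restrict' hU.measurableSet, Set.inter_comm]

lemma lintegral_patchPerimeter (hU : IsOpen U) (h : ContDiffOn ℝ 1 θ U) {f : Heis → ENNReal}
    (hf : Measurable f) :
    ∫⁻ g, f g ∂(patchPerimeter U θ) = ∫⁻ u in U, ENNReal.ofReal (density θ u) * f (θ u) := by
  rw [patchPerimeter_eq, lintegral_map' hf.aemeasurable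
      (aemeasurable_withDensity hU h.continuousOn _),
    lintegral_withDensity_eq_lintegral_mul_non_measurable₀ _ (aemeasurable_density hU h) (by simp)]
  rfl

lemma integral_patchPerimeter (hU : IsOpen U) (h : ContDiffOn ℝ 1 θ U) {f : Heis → ℝ}
    (hf : AEStronglyMeasurable f (patchPerimeter U θ)) :
    ∫ g, f g ∂(patchPerimeter U θ) = ∫ u in U, density θ u * f (θ u) := by
  rw [patchPerimeter_eq] at hf ⊢
  rw [integral_map (aemeasurable_withDensity hU h.continuousOn _) hf,
    integral_withDensity_eq_integral_toReal_smul₀ (aemeasurable_density hU h) (by simp)]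
  simp only [ENNReal.toReal_ofReal (density_nonneg _ _), smul_eq_mul]

lemma patchPerimeter_restrict_of_mapsTo (h : IsPatch M U θ) {A : Set Heis}
    (hA : MeasurableSet A) (hmaps : Set.MapsTo θ U A) :
    (patchPerimeter U θ).restrict A = patchPerimeter U θ := by
  refine Measure.restrict_eq_self_of_ae_mem (ae_iff.2 ?_)
  change patchPerimeter U θ Aᶜ = 0
  have hempty : U ∩ θ ⁻¹' Aᶜ = ∅ := Set.eq_empty_of_forall_notMem fun u hu => hu.2 (hmaps hu.1)
  rw [patchPerimeter_apply h.isOpen h.continuousOn hA.compl, hempty, setLIntegral_empty]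

lemma patchPerimeter_le_perimeter (h : IsPatch M U θ) : patchPerimeter U θ ≤ perimeter M :=
  le_iSup (fun P : {P : Set (ℝ × ℝ) × (ℝ × ℝ → Heis) // IsPatch M P.1 P.2} =>
    patchPerimeter P.1.1 P.1.2) ⟨(U, θ), h⟩

lemma perimeter_le {ν : Measure Heis} (h : ∀ U θ, IsPatch M U θ → patchPerimeter U θ ≤ ν) :
    perimeter M ≤ ν :=
  iSup_le fun P => h _ _ P.2

lemma perimeter_restrict_self (hM : MeasurableSet M) :
    (perimeter M).restrict M = perimeter M :=
  Measure.restrict_le_self.antisymm <| perimeter_le fun _ _ h => by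
    rw [← patchPerimeter_restrict_of_mapsTo h hM h.mapsTo]
    exact Measure.restrict_mono le_rfl (patchPerimeter_le_perimeter h)

lemma patchPerimeter_restrict_le (hO : IsOpen O) (hθ : IsPatch M U θ) (hθ' : IsPatch M U' θ')
    (hπ : Differentiable ℝ π) (hinv : ∀ g ∈ M ∩ O, π g ∈ U ∧ θ (π g) = g) :
    (patchPerimeter U' θ').restrict O ≤ patchPerimeter U θ := by
  refine Measure.le_iff.2 fun A hA => ?_
  rw [Measure.restrict_apply hA, patchPerimeter_apply hθ.isOpen hθ.continuousOn hA,
    patchPerimeter_apply hθ'.isOpen hθ'.continuousOn (hA.inter hO.measurableSet)]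
  set D := U' ∩ θ' ⁻¹' (A ∩ O)
  have hD : MeasurableSet D := measurableSet_inter_preimage_of_continuousOn hθ'.continuousOn
    hθ'.isOpen.measurableSet (hA.inter hO.measurableSet)
  have hψ : ∀ u ∈ D, DifferentiableAt ℝ (π ∘ θ') u := fun u hu =>
    (hπ _).comp u (hθ'.differentiableAt hu.1)
  have hloc : ∀ u ∈ U' ∩ θ' ⁻¹' O, π (θ' u) ∈ U ∧ θ (π (θ' u)) = θ' u := fun u hu =>
    hinv _ ⟨hθ'.mapsTo hu.1, hu.2⟩
  have hDO : D ⊆ U' ∩ θ' ⁻¹' O := fun u hu => ⟨hu.1, hu.2.2⟩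
  have hdensity : ∀ u ∈ D, density θ' u =
      |(fderiv ℝ (π ∘ θ') u).det| * density θ ((π ∘ θ') u) := fun u hu => by
    refine density_comp (hθ.differentiableAt (hloc u (hDO hu)).1) (hψ u hu) ?_
    filter_upwards [(hθ'.continuousOn.isOpen_inter_preimage hθ'.isOpen hO).mem_nhds (hDO hu)]
      with w hw using (hloc w hw).2.symm
  have hinj : D.InjOn (π ∘ θ') := fun u hu w hw huw => hθ'.injOn hu.1 hw.1 <| by
    rw [← (hloc u (hDO hu)).2, ← (hloc w (hDO hw)).2]
    exact congrArg θ huw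
  calc ∫⁻ u in D, ENNReal.ofReal (density θ' u)
      = ∫⁻ u in D, ENNReal.ofReal |(fderiv ℝ (π ∘ θ') u).det| *
          ENNReal.ofReal (density θ ((π ∘ θ') u)) :=
        setLIntegral_congr_fun hD fun u hu => by
          rw [hdensity u hu, ENNReal.ofReal_mul (abs_nonneg _)]
    _ = ∫⁻ u in (π ∘ θ') '' D, ENNReal.ofReal (density θ u) :=
        (lintegral_image_eq_lintegral_abs_det_fderiv_mul volume hD
          (fun u hu => (hψ u hu).hasFDerivAt.hasFDerivWithinAt) hinj
          fun u => ENNReal.ofReal (density θ u)).symm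
    _ ≤ ∫⁻ u in U ∩ θ ⁻¹' A, ENNReal.ofReal (density θ u) := by
        refine lintegral_mono_set (Set.image_subset_iff.2 fun u hu => ⟨(hloc u (hDO hu)).1, ?_⟩)
        rw [Set.mem_preimage, Function.comp_apply, (hloc u (hDO hu)).2]
        exact hu.2.1

lemma perimeter_restrict_eq_patchPerimeter (hO : IsOpen O) (hθ : IsPatch M U θ)
    (hθO : Set.MapsTo θ U O) (hπ : Differentiable ℝ π)
    (hinv : ∀ g ∈ M ∩ O, π g ∈ U ∧ θ (π g) = g) :
    (perimeter M).restrict O = patchPerimeter U θ := by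
  refine le_antisymm ?_ ?_
  · have hle : perimeter M ≤ patchPerimeter U θ + (perimeter M).restrict Oᶜ :=
      perimeter_le fun U' θ' hθ' => by
        rw [← Measure.restrict_add_restrict_compl (μ := patchPerimeter U' θ') hO.measurableSet]
        exact add_le_add (patchPerimeter_restrict_le hO hθ hθ' hπ hinv)
          (Measure.restrict_mono le_rfl (patchPerimeter_le_perimeter hθ'))
    calc (perimeter M).restrict O
        ≤ (patchPerimeter U θ + (perimeter M).restrict Oᶜ).restrict O :=
          Measure.restrict_mono le_rfl hle
      _ = (patchPerimeter U θ).restrict O := by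
          rw [Measure.restrict_add, Measure.restrict_restrict hO.measurableSet,
            Set.inter_compl_self, Measure.restrict_empty, add_zero]
      _ ≤ patchPerimeter U θ := Measure.restrict_le_self
  · rw [← patchPerimeter_restrict_of_mapsTo hθ hO.measurableSet hθO]
    exact Measure.restrict_mono le_rfl (patchPerimeter_le_perimeter hθ)

lemma IsPatch.comp (h : IsPatch M U θ) {Φ : Heis ≃ₜ Heis} (hΦ : ContDiff ℝ 1 Φ)
    (hΦ' : ContDiff ℝ 1 Φ.symm) : IsPatch (Φ '' M) U (Φ ∘ θ) where
  isOpen := h.isOpen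
  contDiffOn := hΦ.comp_contDiffOn h.contDiffOn
  injOn := Φ.injective.comp_injOn h.injOn
  immersion u hu := by
    have hleft : (fderiv ℝ Φ.symm (Φ (θ u))).comp (fderiv ℝ Φ (θ u)) = .id ℝ Heis := by
      rw [← fderiv_comp _ (hΦ'.differentiable one_ne_zero _) (hΦ.differentiable one_ne_zero _),
        Φ.symm_comp_self, fderiv_id]
    rw [fderiv_comp u (hΦ.differentiable one_ne_zero _) (h.differentiableAt hu)]
    exact Function.Injective.comp (g := fderiv ℝ Φ (θ u))
      (Function.LeftInverse.injective fun v => DFunLike.congr_fun hleft v) (h.immersion u hu)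
  mapsTo u hu := ⟨θ u, h.mapsTo hu, rfl⟩

lemma patchPerimeter_comp (h : IsPatch M U θ) {Φ : Heis → Heis} (hΦ : Continuous Φ) {j : Heis → ℝ}
    (hj : Measurable j) (hd : ∀ u ∈ U, density (Φ ∘ θ) u = j (θ u) * density θ u) :
    patchPerimeter U (Φ ∘ θ) =
      ((patchPerimeter U θ).withDensity fun g => ENNReal.ofReal (j g)).map Φ := by
  refine Measure.ext fun A hA => ?_
  have hA' : MeasurableSet (Φ ⁻¹' A) := hΦ.measurable hA
  have hpre : MeasurableSet (U ∩ (Φ ∘ θ) ⁻¹' A) := measurableSet_inter_preimage_of_continuousOn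
    (hΦ.comp_continuousOn h.continuousOn) h.isOpen.measurableSet hA
  rw [patchPerimeter_apply h.isOpen (hΦ.comp_continuousOn h.continuousOn) hA,
    Measure.map_apply hΦ.measurable hA, withDensity_apply _ hA', ← lintegral_indicator hA',
    lintegral_patchPerimeter h.isOpen h.contDiffOn (hj.ennreal_ofReal.indicator hA'),
    ← lintegral_indicator hpre, ← lintegral_indicator h.isOpen.measurableSet]
  refine lintegral_congr fun u => ?_
  by_cases hu : u ∈ U <;> by_cases hAu : Φ (θ u) ∈ A <;>
    simp [Set.indicator, hu, hAu, hd, ENNReal.ofReal_mul', density_nonneg, mul_comm]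

lemma perimeter_image {Φ : Heis ≃ₜ Heis} (hΦ : ContDiff ℝ 1 Φ) (hΦ' : ContDiff ℝ 1 Φ.symm)
    {j : Heis → ℝ} (hj : Measurable j) (hj0 : ∀ g, 0 < j g)
    (hd : ∀ U θ, IsPatch M U θ → ∀ u ∈ U, density (Φ ∘ θ) u = j (θ u) * density θ u) :
    perimeter (Φ '' M) = ((perimeter M).withDensity fun g => ENNReal.ofReal (j g)).map Φ := by
  let e := mapWithDensity Φ.toMeasurableEquiv hj.ennreal_ofReal
    (fun g => by simpa using hj0 g) (fun g => ENNReal.ofReal_ne_top)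
  have he : ∀ U θ, IsPatch M U θ → e (patchPerimeter U θ) = patchPerimeter U (Φ ∘ θ) :=
    fun U θ h => (patchPerimeter_comp h Φ.continuous hj (hd U θ h)).symm
  refine le_antisymm (perimeter_le fun U θ h => ?_) ?_
  · have hback : IsPatch M U (Φ.symm ∘ θ) := by
      have := h.comp hΦ' hΦ
      rwa [← Set.image_comp, Φ.symm_comp_self, Set.image_id] at this
    have hθ : Φ ∘ Φ.symm ∘ θ = θ := by rw [← Function.comp_assoc, Φ.self_comp_symm]; rfl
    rw [← hθ, ← he _ _ hback]
    exact e.monotone (patchPerimeter_le_perimeter hback)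
  · change e (perimeter M) ≤ _
    refine e.le_symm_apply.1 (perimeter_le fun U θ h => e.le_symm_apply.2 ?_)
    rw [he U θ h]
    exact patchPerimeter_le_perimeter (h.comp hΦ hΦ')

end Perimeter

/-- A `C²` chart of `M` on the open set `O`, inverse to a linear projection `π`. -/
structure IsChart (M O : Set Heis) (U : Set (ℝ × ℝ)) (θ : ℝ × ℝ → Heis)
    (π : Heis →L[ℝ] ℝ × ℝ) : Prop where
  isOpen_nhd : IsOpen O
  isOpen : IsOpen U
  contDiffOn : ContDiffOn ℝ 2 θ U
  mapsTo : Set.MapsTo θ U M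
  mapsTo_nhd : Set.MapsTo θ U O
  proj_apply : ∀ u ∈ U, π (θ u) = u
  inv : ∀ g ∈ M ∩ O, π g ∈ U ∧ θ (π g) = g

namespace IsChart

variable {M O : Set Heis} {U : Set (ℝ × ℝ)} {θ : ℝ × ℝ → Heis} {π : Heis →L[ℝ] ℝ × ℝ}

lemma differentiableAt (h : IsChart M O U θ π) {u : ℝ × ℝ} (hu : u ∈ U) :
    DifferentiableAt ℝ θ u :=
  (h.contDiffOn.contDiffAt (h.isOpen.mem_nhds hu)).differentiableAt two_ne_zero

lemma proj_fderiv (h : IsChart M O U θ π) {u : ℝ × ℝ} (hu : u ∈ U) (v : ℝ × ℝ) :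
    π (fderiv ℝ θ u v) = v := by
  have hcomp : fderiv ℝ (π ∘ θ) u = π.comp (fderiv ℝ θ u) := by
    rw [fderiv_comp u π.differentiableAt (h.differentiableAt hu), π.fderiv]
  have hid : π ∘ θ =ᶠ[𝓝 u] id := by
    filter_upwards [h.isOpen.mem_nhds hu] with w hw using h.proj_apply w hw
  rw [hid.fderiv_eq, fderiv_id] at hcomp
  exact (DFunLike.congr_fun hcomp v).symm

lemma isPatch (h : IsChart M O U θ π) : IsPatch M U θ where
  isOpen := h.isOpen
  contDiffOn := h.contDiffOn.of_le one_le_two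
  injOn u hu w hw huw := by rw [← h.proj_apply u hu, ← h.proj_apply w hw, huw]
  immersion _ hu := Function.LeftInverse.injective (g := π) (h.proj_fderiv hu)
  mapsTo := h.mapsTo

lemma perimeter_restrict (h : IsChart M O U θ π) :
    (perimeter M).restrict O = patchPerimeter U θ :=
  perimeter_restrict_eq_patchPerimeter h.isOpen_nhd h.isPatch h.mapsTo_nhd π.differentiable h.inv

end IsChart

/-! ### One-forms and their curl -/

section Regularity

variable {φ : Heis → ℝ} {g : Heis}

lemma contDiff_X1 {n : WithTop ℕ∞} : ContDiff ℝ n X1 := by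
  unfold X1; fun_prop

lemma contDiff_X2 {n : WithTop ℕ∞} : ContDiff ℝ n X2 := by
  unfold X2; fun_prop

lemma contDiff_T {n : WithTop ℕ∞} : ContDiff ℝ n T := by
  unfold T; fun_prop

lemma contDiffAt_along {V : Heis → Heis} {f : Heis → ℝ} (hV : ContDiffAt ℝ 1 V g)
    (hf : ContDiffAt ℝ 2 f g) : ContDiffAt ℝ 1 (along V f) g :=
  (hf.fderiv_right (m := 1) (by norm_num)).clm_apply hV

lemma contDiffAt_W (hφ : ContDiffAt ℝ 2 φ g) (hW : W φ g ≠ 0) : ContDiffAt ℝ 1 (W φ) g :=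
  (((contDiffAt_along contDiff_X1.contDiffAt hφ).pow 2).add
    ((contDiffAt_along contDiff_X2.contDiffAt hφ).pow 2)).sqrt
    (W_sq.symm.trans_ne (pow_ne_zero 2 hW))

lemma contDiffAt_pbar (hφ : ContDiffAt ℝ 2 φ g) (hW : W φ g ≠ 0) : ContDiffAt ℝ 1 (pbar φ) g :=
  (contDiffAt_along contDiff_X1.contDiffAt hφ).div (contDiffAt_W hφ hW) hW

lemma contDiffAt_qbar (hφ : ContDiffAt ℝ 2 φ g) (hW : W φ g ≠ 0) : ContDiffAt ℝ 1 (qbar φ) g :=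
  (contDiffAt_along contDiff_X2.contDiffAt hφ).div (contDiffAt_W hφ hW) hW

lemma contDiffAt_omegabar (hφ : ContDiffAt ℝ 2 φ g) (hW : W φ g ≠ 0) :
    ContDiffAt ℝ 1 (omegabar φ) g :=
  (contDiffAt_along contDiff_T.contDiffAt hφ).div (contDiffAt_W hφ hW) hW

lemma contDiffAt_hnormal (hφ : ContDiffAt ℝ 2 φ g) (hW : W φ g ≠ 0) :
    ContDiffAt ℝ 1 (hnormal φ) g := by
  refine contDiffAt_pi.2 fun i => ?_
  fin_cases i
  exacts [contDiffAt_pbar hφ hW, contDiffAt_qbar hφ hW, contDiffAt_omegabar hφ hW]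

lemma pbar_mul_fderiv_add (hφ : ContDiffAt ℝ 2 φ g) (hW : W φ g ≠ 0) (v : Heis) :
    pbar φ g * fderiv ℝ (pbar φ) g v + qbar φ g * fderiv ℝ (qbar φ) g v = 0 := by
  have hp := ((contDiffAt_pbar hφ hW).differentiableAt one_ne_zero).hasFDerivAt
  have hq := ((contDiffAt_qbar hφ hW).differentiableAt one_ne_zero).hasFDerivAt
  have hone : (fun h => pbar φ h ^ 2 + qbar φ h ^ 2) =ᶠ[𝓝 g] fun _ => 1 := by
    filter_upwards [(contDiffAt_W hφ hW).continuousAt.eventually_ne hW] with h hh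
      using pbar_sq_add_qbar_sq hh
  have hderiv := congrArg (fun A => A v) <|
    (((hp.pow 2).add (hq.pow 2)).congr_of_eventuallyEq hone.symm).unique
      (hasFDerivAt_const (1 : ℝ) g)
  simp only [_root_.add_apply, _root_.smul_apply, _root_.zero_apply, nsmul_eq_mul, smul_eq_mul,
    Nat.cast_ofNat, Nat.add_one_sub_one, pow_one] at hderiv
  linarith

lemma fderiv_Z_eq_zero : fderiv ℝ φ g (Z φ g) = 0 := by
  rw [fderiv_apply_Z, pbar, qbar]
  ring

end Regularity

section Curl

variable {φ f : Heis → ℝ} {α β : Heis → Fin 3 → ℝ} {g : Heis}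

/-- The curl of the one-form with components `α` in the frame dual to `X₁, X₂, T`: the component
`i` is the value of its exterior derivative on the other two fields, in cyclic order. The last
term of the third component comes from `[X₁, X₂] = T`. -/
def curl (α : Heis → Fin 3 → ℝ) (g : Heis) : Fin 3 → ℝ :=
  ![fderiv ℝ α g (X2 g) 2 - fderiv ℝ α g (T g) 1, fderiv ℝ α g (T g) 0 - fderiv ℝ α g (X1 g) 2,
    fderiv ℝ α g (X1 g) 1 - fderiv ℝ α g (X2 g) 0 - α g 2]

lemma curl_sub (hα : DifferentiableAt ℝ α g) (hβ : DifferentiableAt ℝ β g) :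
    curl (α - β) g = curl α g - curl β g := by
  ext i
  fin_cases i <;> simp [curl, fderiv_sub hα hβ] <;> ring

lemma curl_sum {ι : Type*} {t : Finset ι} {α : ι → Heis → Fin 3 → ℝ}
    (hα : ∀ i ∈ t, DifferentiableAt ℝ (α i) g) :
    curl (∑ i ∈ t, α i) g = ∑ i ∈ t, curl (α i) g := by
  ext i
  fin_cases i <;> simp [curl, fderiv_sum hα, Finset.sum_sub_distrib]

lemma curl_smul (hf : DifferentiableAt ℝ f g) (hβ : DifferentiableAt ℝ β g) :
    curl (f • β) g = rgrad f g ⨯₃ β g + f g • curl β g := by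
  ext i
  fin_cases i <;> simp [curl, fderiv_smul hf hβ, cross_apply, rgrad, along] <;> ring

lemma continuousAt_curl (hα : ContDiffAt ℝ 1 α g) : ContinuousAt (curl α) g := by
  have hfderiv : ContinuousAt (fderiv ℝ α) g :=
    (hα.fderiv_right (m := 0) (by norm_num)).continuousAt
  have hα := hα.continuousAt
  have happly {V : Heis → Heis} (hV : Continuous V) (i : Fin 3) :
      ContinuousAt (fun g => fderiv ℝ α g (V g) i) g :=
    (continuous_apply i).continuousAt.comp (hfderiv.clm_apply hV.continuousAt)
  have hX1 := happly (contDiff_X1 (n := 0)).continuous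
  have hX2 := happly (contDiff_X2 (n := 0)).continuous
  have hT := happly (contDiff_T (n := 0)).continuous
  refine continuousAt_pi.2 fun i => ?_
  fin_cases i
  exacts [(hX2 2).sub (hT 1), (hT 0).sub (hX1 2),
    ((hX1 1).sub (hX2 0)).sub ((continuous_apply 2).continuousAt.comp hα)]

lemma rgrad_dotProduct_curl_congr (hα : ContDiffAt ℝ 1 α g) (hβ : ContDiffAt ℝ 1 β g)
    (hφ : ContDiffAt ℝ 1 φ g) (hφ' : fderiv ℝ φ g ≠ 0)
    (h : α =ᶠ[𝓝[{h | φ h = φ g}] g] β) :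
    rgrad φ g ⬝ᵥ curl α g = rgrad φ g ⬝ᵥ curl β g := by
  have hγ : ContDiffAt ℝ 1 (α - β) g := hα.sub hβ
  have hzero : α g = β g := h.self_of_nhdsWithin rfl
  choose c hc using fun i => exists_fderiv_eq_smul_of_eventuallyEq_zero (contDiffAt_pi.1 hγ i)
    hφ hφ' (h.mono fun h hh => by simp [hh])
  have hcurl : curl (α - β) g = rgrad φ g ⨯₃ c := by
    have hderiv : ∀ v i, fderiv ℝ (α - β) g v i = c i * fderiv ℝ φ g v := fun v i => by
      rw [← smul_eq_mul, ← _root_.smul_apply, ← hc, fderiv_apply (hγ.differentiableAt one_ne_zero)]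
      rfl
    ext i
    fin_cases i <;> simp [curl, hderiv, cross_apply, rgrad, along, hzero, mul_comm]
  rw [← sub_eq_zero, ← dotProduct_sub, ← curl_sub (hα.differentiableAt one_ne_zero)
    (hβ.differentiableAt one_ne_zero), hcurl, dot_self_cross]

end Curl

section StokesForm

variable {φ a : Heis → ℝ} {g : Heis}

/-- The one-form, in the frame dual to `X₁, X₂, T`, whose multiple by `a²` has as its exterior
derivative on a surface the difference between the second derivative of the area density and the
claimed integrand. -/
def stokesForm (φ : Heis → ℝ) (g : Heis) : Fin 3 → ℝ :=
  ![-(pbar φ g * qbar φ g ^ 2), pbar φ g ^ 2 * qbar φ g, -omegabar φ g]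

lemma contDiffAt_stokesForm (hφ : ContDiffAt ℝ 2 φ g) (hW : W φ g ≠ 0) :
    ContDiffAt ℝ 1 (stokesForm φ) g := by
  have hp := contDiffAt_pbar hφ hW
  have hq := contDiffAt_qbar hφ hW
  refine contDiffAt_pi.2 fun i => ?_
  fin_cases i
  exacts [(hp.mul (hq.pow 2)).neg, (hp.pow 2).mul hq, (contDiffAt_omegabar hφ hW).neg]

lemma fderiv_stokesForm (hφ : ContDiffAt ℝ 2 φ g) (hW : W φ g ≠ 0) (v : Heis) :
    fderiv ℝ (stokesForm φ) g v =
      ![-(fderiv ℝ (pbar φ) g v * qbar φ g ^ 2 +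
          2 * pbar φ g * qbar φ g * fderiv ℝ (qbar φ) g v),
        2 * pbar φ g * qbar φ g * fderiv ℝ (pbar φ) g v + pbar φ g ^ 2 * fderiv ℝ (qbar φ) g v,
        -fderiv ℝ (omegabar φ) g v] := by
  have hp := ((contDiffAt_pbar hφ hW).differentiableAt one_ne_zero).hasFDerivAt
  have hq := ((contDiffAt_qbar hφ hW).differentiableAt one_ne_zero).hasFDerivAt
  have hω := ((contDiffAt_omegabar hφ hW).differentiableAt one_ne_zero).hasFDerivAt
  have hdiff := (contDiffAt_stokesForm hφ hW).differentiableAt one_ne_zero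
  ext i
  have hcomp : fderiv ℝ (stokesForm φ) g v i = fderiv ℝ (fun h => stokesForm φ h i) g v := by
    rw [fderiv_apply hdiff]
    rfl
  rw [hcomp]
  fin_cases i
  · refine (congrArg (· v) (hp.mul (hq.pow 2)).neg.fderiv).trans ?_
    simp only [Nat.add_one_sub_one, pow_one, nsmul_eq_mul, Nat.cast_ofNat, _root_.add_apply,
      _root_.neg_apply, _root_.smul_apply, smul_eq_mul, Fin.zero_eta, cons_val_zero]
    ring
  · refine (congrArg (· v) ((hp.pow 2).mul hq).fderiv).trans ?_
    simp only [Nat.add_one_sub_one, pow_one, nsmul_eq_mul, Nat.cast_ofNat, _root_.add_apply,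
      _root_.smul_apply, smul_eq_mul, Fin.mk_one, cons_val_zero, cons_val_one]
    ring
  · exact congrArg (· v) hω.neg.fderiv

lemma hnormal_dotProduct_curl_stokesForm (hφ : ContDiffAt ℝ 2 φ g) (hW : W φ g ≠ 0) :
    hnormal φ g ⬝ᵥ curl (stokesForm φ) g = pbar φ g ^ 2 * omegabar φ g ^ 2 - potential φ g := by
  have hsq := pbar_sq_add_qbar_sq hW
  have hY (f : Heis → ℝ) :
      along (Y φ) f g = pbar φ g * along X1 f g + qbar φ g * along X2 f g := by simp [along, Y]
  have hZ : along (Z φ) (omegabar φ) g = _ := fderiv_apply_Z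
  have hT := pbar_mul_fderiv_add hφ hW (T g)
  rw [potential, meanCurvature, hZ, hY, hY, hnormal, curl, vec3_dotProduct]
  simp only [fderiv_stokesForm hφ hW, stokesForm, along, cons_val_zero, cons_val_one, cons_val]
  generalize fderiv ℝ (pbar φ) g = p' at *
  generalize fderiv ℝ (qbar φ) g = q' at *
  linear_combination (-(pbar φ g * q' (T g) + qbar φ g * p' (T g)) - omegabar φ g ^ 2) * hsq
    - pbar φ g * qbar φ g * hT

lemma second_variation_density (hφ : ContDiffAt ℝ 2 φ g) (hW : W φ g ≠ 0)
    (ha : DifferentiableAt ℝ a g) :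
    pbar φ g ^ 2 * normalB φ a g ^ 2 + 2 * qbar φ g * normalC φ a g =
      pbar φ g ^ 2 * tangentialGradSq φ a g + a g ^ 2 * potential φ g +
        hnormal φ g ⬝ᵥ curl (a ^ 2 • stokesForm φ) g := by
  have hsq := pbar_sq_add_qbar_sq hW
  have hderiv (v : Heis) : fderiv ℝ (a ^ 2) g v = 2 * a g * fderiv ℝ a g v :=
    (congrArg (· v) (ha.hasFDerivAt.pow 2).fderiv).trans (by simp)
  rw [curl_smul (ha.pow 2) ((contDiffAt_stokesForm hφ hW).differentiableAt one_ne_zero),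
    dotProduct_add, dotProduct_smul, hnormal_dotProduct_curl_stokesForm hφ hW, normalB, normalC,
    tangentialGradSq_eq_sq hW, fderiv_apply_Z, vec3_dotProduct]
  simp only [cross_apply, rgrad, along, hderiv, hnormal, stokesForm, cons_val_zero, cons_val_one,
    cons_val, Pi.pow_apply, smul_eq_mul]
  linear_combination
    (2 * a g * pbar φ g * qbar φ g * fderiv ℝ a g (T g) -
      2 * a g * omegabar φ g * fderiv ℝ a g (X2 g) * pbar φ g) * hsq

end StokesForm

section Rescaling

variable {φ ψ : Heis → ℝ} {g : Heis} {c : ℝ}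

lemma W_eq_mul (hc : 0 ≤ c) (h : rgrad φ g = c • rgrad ψ g) : W φ g = c * W ψ g := by
  have hX1 : along X1 φ g = c * along X1 ψ g := congrFun h 0
  have hX2 : along X2 φ g = c * along X2 ψ g := congrFun h 1
  rw [W, W, hX1, hX2, mul_pow, mul_pow, ← mul_add, Real.sqrt_mul (sq_nonneg c), Real.sqrt_sq hc]

lemma hnormal_congr (hc : 0 < c) (h : rgrad φ g = c • rgrad ψ g) : hnormal φ g = hnormal ψ g := by
  have hcomp (i : Fin 3) : rgrad φ g i / W φ g = rgrad ψ g i / W ψ g := by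
    rw [W_eq_mul hc.le h, h, Pi.smul_apply, smul_eq_mul, mul_div_mul_left _ _ hc.ne']
  ext i
  fin_cases i
  exacts [hcomp 0, hcomp 1, hcomp 2]

lemma along_eq_zero_of_W_eq_zero (h : W φ g = 0) : along X1 φ g = 0 ∧ along X2 φ g = 0 := by
  have hsum : along X1 φ g ^ 2 + along X2 φ g ^ 2 = 0 := by rw [← W_sq, h, zero_pow two_ne_zero]
  rw [add_eq_zero_iff_of_nonneg (sq_nonneg _) (sq_nonneg _)] at hsum
  exact hsum.imp (pow_eq_zero_iff two_ne_zero).1 (pow_eq_zero_iff two_ne_zero).1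

lemma ker_fderiv_eq_horizontalPlane (h : rgrad φ g ≠ 0) (hW : W φ g = 0) :
    LinearMap.ker (fderiv ℝ φ g : Heis →ₗ[ℝ] ℝ) = horizontalPlane g := by
  obtain ⟨hX1, hX2⟩ := along_eq_zero_of_W_eq_zero hW
  have hT : along T φ g ≠ 0 := fun hT => h <| by
    rw [rgrad, hX1, hX2, hT]
    ext i
    fin_cases i <;> rfl
  refine le_antisymm (fun v hv => ?_) (Submodule.span_le.2 ?_)
  · have hv2 : frameCoord g v 2 = 0 := by
      have hv : fderiv ℝ φ g v = 0 := hv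
      rw [fderiv_apply_eq_dotProduct, vec3_dotProduct] at hv
      simpa only [rgrad, cons_val_zero, cons_val_one, cons_val, hX1, hX2, zero_mul, zero_add,
        mul_eq_zero, hT, false_or] using hv
    rw [← frameCoord_spec g v, hv2, zero_smul, add_zero]
    exact add_mem (Submodule.smul_mem _ _ (Submodule.subset_span (by simp)))
      (Submodule.smul_mem _ _ (Submodule.subset_span (by simp)))
  · rintro v (rfl | rfl)
    exacts [hX1, hX2]

end Rescaling

namespace OrientedC2Surface

variable {S : OrientedC2Surface} {g h : Heis}

lemma contDiffAt (hg : g ∈ S.carrier) (hd : h ∈ S.dom g) : ContDiffAt ℝ 2 (S.φ g) h :=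
  (S.contDiffOn g hg).contDiffAt ((S.isOpen_dom g hg).mem_nhds hd)

lemma fderiv_ne_zero (hg : g ∈ S.carrier) (hd : h ∈ S.dom g) : fderiv ℝ (S.φ g) h ≠ 0 :=
  fun hzero => S.rgrad_ne_zero g hg h hd <| by
    ext i
    fin_cases i <;> simp [rgrad, along, hzero]

lemma φ_eq_zero_iff (hg : g ∈ S.carrier) (hd : h ∈ S.dom g) : S.φ g h = 0 ↔ h ∈ S.carrier := by
  have := Set.ext_iff.1 (S.inter_dom g hg) h
  simp_all

lemma dom_mem_nhdsWithin (hg : g ∈ S.carrier) (hd : h ∈ S.dom g) : S.dom g ∈ 𝓝[S.carrier] h :=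
  mem_nhdsWithin_of_mem_nhds ((S.isOpen_dom g hg).mem_nhds hd)

lemma nhdsWithin_carrier (hg : g ∈ S.carrier) (hh : h ∈ S.carrier) (hd : h ∈ S.dom g) :
    𝓝[S.carrier] h = 𝓝[{w | S.φ g w = S.φ g h}] h := by
  refine nhdsWithin_eq_nhdsWithin hd (S.isOpen_dom g hg) ?_
  ext w
  rw [(S.φ_eq_zero_iff hg hd).2 hh, Set.mem_inter_iff, Set.mem_inter_iff,
    and_congr_left fun hw => (S.φ_eq_zero_iff hg hw).symm]
  rfl

lemma measurableSet_carrier (S : OrientedC2Surface) : MeasurableSet S.carrier := by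
  have hlocal : IsLocallyClosed S.carrier := by
    refine ((isLocallyClosed_tfae S.carrier).out 0 3 rfl rfl).2 fun g hg =>
      ⟨S.dom g, S.mem_dom g hg, S.isOpen_dom g hg, ?_⟩
    rintro h ⟨hd, hc⟩
    have hne : (𝓝[S.carrier] h).NeBot := mem_closure_iff_nhdsWithin_neBot.1 hc
    have hev : S.φ g =ᶠ[𝓝[S.carrier] h] fun _ => 0 := by
      filter_upwards [self_mem_nhdsWithin, S.dom_mem_nhdsWithin hg hd] with w hw hwd
      exact (S.φ_eq_zero_iff hg hwd).2 hw
    exact (S.φ_eq_zero_iff hg hd).1 <| tendsto_nhds_unique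
      ((S.contDiffAt hg hd).continuousAt.continuousWithinAt.tendsto)
      (tendsto_const_nhds.congr' hev.symm)
  obtain ⟨A, B, hA, hB, hAB⟩ := hlocal
  exact hAB ▸ hA.measurableSet.inter hB.measurableSet

lemma hnormal_eq (hg : g ∈ S.carrier) (hh : h ∈ S.carrier) (hd : h ∈ S.dom g) :
    hnormal (S.φ g) h = hnormal (S.φ h) h := by
  obtain ⟨c, hc, hr⟩ := S.oriented g hg h hh h ⟨⟨hh, hd⟩, S.mem_dom h hh⟩
  exact hnormal_congr hc hr

lemma W_self_ne_zero (hS : S.charLocus = ∅) (hg : g ∈ S.carrier) : W (S.φ g) g ≠ 0 := fun hW =>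
  Set.eq_empty_iff_forall_notMem.1 hS g
    ⟨hg, ker_fderiv_eq_horizontalPlane (S.rgrad_ne_zero g hg g (S.mem_dom g hg)) hW⟩

lemma W_ne_zero (hS : S.charLocus = ∅) (hg : g ∈ S.carrier) (hh : h ∈ S.carrier)
    (hd : h ∈ S.dom g) : W (S.φ g) h ≠ 0 := by
  obtain ⟨c, hc, hr⟩ := S.oriented g hg h hh h ⟨⟨hh, hd⟩, S.mem_dom h hh⟩
  rw [W_eq_mul hc.le hr]
  exact mul_ne_zero hc.ne' (W_self_ne_zero hS hh)

lemma dotProduct_curl_congr (hS : S.charLocus = ∅) (hg : g ∈ S.carrier)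
    {α β : Heis → Fin 3 → ℝ} (hα : ContDiffAt ℝ 1 α g) (hβ : ContDiffAt ℝ 1 β g)
    (h : α =ᶠ[𝓝[S.carrier] g] β) :
    hnormal (S.φ g) g ⬝ᵥ curl α g = hnormal (S.φ g) g ⬝ᵥ curl β g := by
  have hself := S.mem_dom g hg
  have hW := S.W_self_ne_zero hS hg
  rw [S.nhdsWithin_carrier hg hg hself] at h
  have hcurl := rgrad_dotProduct_curl_congr hα hβ ((S.contDiffAt hg hself).of_le one_le_two)
    (S.fderiv_ne_zero hg hself) h
  rw [rgrad_eq_smul_hnormal hW, smul_dotProduct, smul_dotProduct] at hcurl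
  exact smul_right_injective ℝ hW hcurl

/-- `α g`, defined near each point `g` of the surface, is a `C¹` extension of the map
`h ↦ α h h` on the surface, as in the definition of a tangential derivative. -/
structure IsLocalExtension (S : OrientedC2Surface) (α : Heis → Heis → Fin 3 → ℝ) : Prop where
  contDiffAt : ∀ g ∈ S.carrier, ContDiffAt ℝ 1 (α g) g
  eventually_eq : ∀ g ∈ S.carrier, ∀ᶠ h in 𝓝[S.carrier] g, α g h = α h h

lemma isLocalExtension_of_dom {F : (Heis → ℝ) → Heis → Fin 3 → ℝ}
    (hF : ∀ g ∈ S.carrier, ContDiffAt ℝ 1 (F (S.φ g)) g)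
    (h : ∀ g ∈ S.carrier, ∀ h ∈ S.carrier ∩ S.dom g, F (S.φ g) h = F (S.φ h) h) :
    S.IsLocalExtension fun g => F (S.φ g) where
  contDiffAt := hF
  eventually_eq g hg := by
    filter_upwards [self_mem_nhdsWithin, S.dom_mem_nhdsWithin hg (S.mem_dom g hg)] with w hw hd
    exact h g hg w ⟨hw, hd⟩

lemma isLocalExtension_hnormal (hS : S.charLocus = ∅) :
    S.IsLocalExtension fun g => hnormal (S.φ g) :=
  isLocalExtension_of_dom
    (fun g hg => contDiffAt_hnormal (S.contDiffAt hg (S.mem_dom g hg)) (S.W_self_ne_zero hS hg))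
    fun _ hg _ hh => S.hnormal_eq hg hh.1 hh.2

lemma isLocalExtension_stokesForm (hS : S.charLocus = ∅) :
    S.IsLocalExtension fun g => stokesForm (S.φ g) :=
  isLocalExtension_of_dom
    (fun g hg => contDiffAt_stokesForm (S.contDiffAt hg (S.mem_dom g hg))
      (S.W_self_ne_zero hS hg))
    fun g hg h hh => by
      have hn := S.hnormal_eq hg hh.1 hh.2
      have hp : pbar (S.φ g) h = pbar (S.φ h) h := congrFun hn 0
      have hq : qbar (S.φ g) h = qbar (S.φ h) h := congrFun hn 1
      have hω : omegabar (S.φ g) h = omegabar (S.φ h) h := congrFun hn 2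
      simp only [stokesForm, hp, hq, hω]

namespace IsLocalExtension

variable {α : Heis → Heis → Fin 3 → ℝ}

lemma smul (hα : S.IsLocalExtension α) {f : Heis → ℝ} (hf : ContDiff ℝ 1 f) :
    S.IsLocalExtension fun g => f • α g where
  contDiffAt g hg := hf.contDiffAt.smul (hα.contDiffAt g hg)
  eventually_eq g hg := (hα.eventually_eq g hg).mono fun h hh => by
    simp only [Pi.smul_apply', hh]

lemma continuousOn (hα : S.IsLocalExtension α) : ContinuousOn (fun g => α g g) S.carrier :=
  fun g hg => (hα.contDiffAt g hg).continuousAt.continuousWithinAt.congr_of_eventuallyEq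
    ((hα.eventually_eq g hg).mono fun _ => Eq.symm) rfl

lemma eventually_contDiffAt_and_eventuallyEq (hα : S.IsLocalExtension α) (hg : g ∈ S.carrier) :
    ∀ᶠ h in 𝓝[S.carrier] g, ContDiffAt ℝ 1 (α g) h ∧ α g =ᶠ[𝓝[S.carrier] h] α h := by
  filter_upwards [self_mem_nhdsWithin, nhdsWithin_le_nhds
      ((hα.contDiffAt g hg).eventually (by simp)),
    eventually_eventually_nhdsWithin.2 (hα.eventually_eq g hg)] with h hh hC1 hgh
  refine ⟨hC1, ?_⟩
  filter_upwards [hgh, hα.eventually_eq h hh] with w hgw hhw using hgw.trans hhw.symm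

lemma eventually_dotProduct_curl_eq (hS : S.charLocus = ∅) (hα : S.IsLocalExtension α)
    (hg : g ∈ S.carrier) :
    ∀ᶠ h in 𝓝[S.carrier] g,
      hnormal (S.φ g) h ⬝ᵥ curl (α g) h = hnormal (S.φ h) h ⬝ᵥ curl (α h) h := by
  filter_upwards [self_mem_nhdsWithin, S.dom_mem_nhdsWithin hg (S.mem_dom g hg),
    hα.eventually_contDiffAt_and_eventuallyEq hg] with h hh hd hgh
  rw [S.hnormal_eq hg hh hd]
  exact S.dotProduct_curl_congr hS hh hgh.1 (hα.contDiffAt h hh) hgh.2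

lemma continuousOn_dotProduct_curl (hS : S.charLocus = ∅) (hα : S.IsLocalExtension α) :
    ContinuousOn (fun g => hnormal (S.φ g) g ⬝ᵥ curl (α g) g) S.carrier := fun g hg => by
  have hcont : ContinuousAt (fun h => hnormal (S.φ g) h ⬝ᵥ curl (α g) h) g :=
    (Continuous.dotProduct continuous_fst continuous_snd).continuousAt.comp₂
      ((isLocalExtension_hnormal hS).contDiffAt g hg).continuousAt
      (continuousAt_curl (hα.contDiffAt g hg))
  exact hcont.continuousWithinAt.congr_of_eventuallyEq
    ((hα.eventually_dotProduct_curl_eq hS hg).mono fun _ => Eq.symm) rfl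

end IsLocalExtension

lemma continuousOn_pbar (hS : S.charLocus = ∅) :
    ContinuousOn (fun g => pbar (S.φ g) g) S.carrier :=
  continuousOn_pi.1 (isLocalExtension_hnormal hS).continuousOn 0

lemma continuousOn_qbar (hS : S.charLocus = ∅) :
    ContinuousOn (fun g => qbar (S.φ g) g) S.carrier :=
  continuousOn_pi.1 (isLocalExtension_hnormal hS).continuousOn 1

lemma continuousOn_omegabar (hS : S.charLocus = ∅) :
    ContinuousOn (fun g => omegabar (S.φ g) g) S.carrier :=
  continuousOn_pi.1 (isLocalExtension_hnormal hS).continuousOn 2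

lemma continuousOn_potential (hS : S.charLocus = ∅) :
    ContinuousOn (fun g => potential (S.φ g) g) S.carrier := by
  refine ((((continuousOn_pbar hS).pow 2).mul ((continuousOn_omegabar hS).pow 2)).sub
    ((isLocalExtension_stokesForm hS).continuousOn_dotProduct_curl hS)).congr fun g hg => ?_
  have hcurl := hnormal_dotProduct_curl_stokesForm (S.contDiffAt hg (S.mem_dom g hg))
    (S.W_self_ne_zero hS hg)
  exact eq_sub_of_add_eq' (sub_eq_iff_eq_add.1 hcurl.symm).symm

end OrientedC2Surface

/-! ### Stokes' theorem on the surface -/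

section Charts

variable {M O V : Set Heis} {U : Set (ℝ × ℝ)} {θ : ℝ × ℝ → Heis} {π : Heis →L[ℝ] ℝ × ℝ}

lemma exists_isChart {φ : Heis → ℝ} {g : Heis} (hφ : ContDiffAt ℝ 2 φ g)
    (hφ' : fderiv ℝ φ g ≠ 0) (hV : V ∈ 𝓝 g) (hM : ∀ h ∈ V, h ∈ M ↔ φ h = 0) :
    ∃ O U θ π, IsChart M O U θ π ∧ g ∈ O ∧ O ⊆ V := by
  obtain ⟨A, hA⟩ := exists_continuousLinearEquiv_prod (F := ℝ × ℝ) (by simp) hφ'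
  let π : Heis →L[ℝ] ℝ × ℝ := (ContinuousLinearMap.snd ℝ ℝ (ℝ × ℝ)).comp (A : Heis →L[ℝ] ℝ × ℝ × ℝ)
  have hA' : (A : Heis →L[ℝ] ℝ × ℝ × ℝ) = (fderiv ℝ φ g).prod π :=
    ContinuousLinearMap.ext fun v => Prod.ext (hA v) rfl
  obtain ⟨e, he, hge, heV, hsymm⟩ := exists_openPartialHomeomorph_contDiffOn_symm
    (f := fun h => (φ h, π h)) two_ne_zero (by simp) (hφ.prodMk π.contDiff.contDiffAt)
    (hA' ▸ (hφ.differentiableAt two_ne_zero).hasFDerivAt.prodMk π.hasFDerivAt) hV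
  have hright {u : ℝ × ℝ} (hu : (0, u) ∈ e.target) :
      (φ (e.symm (0, u)), π (e.symm (0, u))) = (0, u) := by
    have := e.right_inv hu
    rwa [he] at this
  have happly {h : Heis} (hh : h ∈ M ∩ e.source) : e h = (0, π h) := by
    simp only [he, (hM h (heV hh.2)).1 hh.1]
  refine ⟨e.source, {u | (0, u) ∈ e.target}, fun u => e.symm (0, u), π, ?_, hge, heV⟩
  exact {
    isOpen_nhd := e.open_source
    isOpen := e.open_target.preimage (by fun_prop)
    contDiffOn := hsymm.comp (contDiff_const.prodMk contDiff_id).contDiffOn fun _ hu => hu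
    mapsTo := fun u hu => (hM _ (heV (e.map_target hu))).2 (congrArg Prod.fst (hright hu))
    mapsTo_nhd := fun u hu => e.map_target hu
    proj_apply := fun u hu => congrArg Prod.snd (hright hu)
    inv := fun h hh => by
      rw [Set.mem_ofPred_eq, ← happly hh]
      exact ⟨e.map_source hh.2, e.left_inv hh.2⟩ }

lemma IsChart.restrict (h : IsChart M O U θ π) {U' : Set (ℝ × ℝ)} (hU' : IsOpen U')
    (hsub : U' ⊆ U) : IsChart M (O ∩ π ⁻¹' U') U' θ π where
  isOpen_nhd := h.isOpen_nhd.inter (hU'.preimage π.continuous)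
  isOpen := hU'
  contDiffOn := h.contDiffOn.mono hsub
  mapsTo := h.mapsTo.mono_left hsub
  mapsTo_nhd u hu := ⟨h.mapsTo_nhd (hsub hu), by
    rwa [Set.mem_preimage, h.proj_apply u (hsub hu)]⟩
  proj_apply u hu := h.proj_apply u (hsub hu)
  inv g hg := ⟨hg.2.2, (h.inv g ⟨hg.1, hg.2.1⟩).2⟩

lemma continuousOn_patchNormal (hU : IsOpen U) (h : ContDiffOn ℝ 1 θ U) :
    ContinuousOn (patchNormal θ) U := by
  have hframe := fun v i => continuousOn_pi.1 (continuousOn_frameCoord_fderiv hU h v) i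
  unfold patchNormal
  simp only [cross_apply]
  fun_prop

namespace OrientedC2Surface

variable {S : OrientedC2Surface} {g : Heis} {u : ℝ × ℝ}

lemma exists_chart (hg : g ∈ S.carrier) (hV : V ∈ 𝓝 g) :
    ∃ O U θ π, IsChart S.carrier O U θ π ∧ g ∈ O ∧ O ⊆ V ∩ S.dom g := by
  have hself := S.mem_dom g hg
  exact exists_isChart (S.contDiffAt hg hself) (S.fderiv_ne_zero hg hself)
    (inter_mem hV ((S.isOpen_dom g hg).mem_nhds hself))
    fun h hh => (S.φ_eq_zero_iff hg hh.2).symm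

lemma exists_patchNormal_eq_smul_hnormal (hS : S.charLocus = ∅) (hθ : IsPatch S.carrier U θ)
    (hg : g ∈ S.carrier) (hu : u ∈ U) (hd : θ u ∈ S.dom g) :
    ∃ c : ℝ, patchNormal θ u = c • hnormal (S.φ g) (θ u) := by
  have hθu := hθ.differentiableAt hu
  obtain ⟨c, hc⟩ := exists_patchNormal_eq_smul_rgrad hθu
    ((S.contDiffAt hg hd).differentiableAt two_ne_zero) (S.rgrad_ne_zero g hg _ hd) <| by
      filter_upwards [hθ.isOpen.mem_nhds hu,
        hθu.continuousAt.preimage_mem_nhds ((S.isOpen_dom g hg).mem_nhds hd)] with w hw hwd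
      exact (S.φ_eq_zero_iff hg hwd).2 (hθ.mapsTo hw)
  rw [rgrad_eq_smul_hnormal (S.W_ne_zero hS hg (hθ.mapsTo hu) hd), smul_smul] at hc
  exact ⟨_, hc⟩

lemma eventually_patchNormal_eq (hS : S.charLocus = ∅) (hθ : IsPatch S.carrier U θ)
    (hg : g ∈ S.carrier) (hu : u ∈ U) (hd : ∀ w ∈ U, θ w ∈ S.dom g) :
    ∃ s : ℝ, s ≠ 0 ∧ ∀ᶠ w in 𝓝 u,
      patchNormal θ w = (s * density θ w) • hnormal (S.φ g) (θ w) := by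
  choose! c hc using fun w hw => exists_patchNormal_eq_smul_hnormal hS hθ hg hw (hd w hw)
  have hW {w} (hw : w ∈ U) : W (S.φ g) (θ w) ≠ 0 := S.W_ne_zero hS hg (hθ.mapsTo hw) (hd w hw)
  let b : ℝ × ℝ → ℝ := fun w =>
    patchNormal θ w 0 * pbar (S.φ g) (θ w) + patchNormal θ w 1 * qbar (S.φ g) (θ w)
  have hcb : ∀ w ∈ U, c w = b w := fun w hw => by
    have h0 : patchNormal θ w 0 = c w * pbar (S.φ g) (θ w) := congrFun (hc w hw) 0
    have h1 : patchNormal θ w 1 = c w * qbar (S.φ g) (θ w) := congrFun (hc w hw) 1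
    linear_combination (-c w) * pbar_sq_add_qbar_sq (hW hw)
      - pbar (S.φ g) (θ w) * h0 - qbar (S.φ g) (θ w) * h1
  have hb : ContinuousAt b u := by
    have hN := (continuousOn_patchNormal hθ.isOpen hθ.contDiffOn).continuousAt
      (hθ.isOpen.mem_nhds hu)
    have hθc := (hθ.differentiableAt hu).continuousAt
    have hφ := S.contDiffAt hg (hd u hu)
    exact ((continuousAt_pi.1 hN 0).mul
      ((contDiffAt_pbar hφ (hW hu)).continuousAt.comp hθc)).add
      ((continuousAt_pi.1 hN 1).mul ((contDiffAt_qbar hφ (hW hu)).continuousAt.comp hθc))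
  have hb0 : b u ≠ 0 := fun hzero => patchNormal_ne_zero (hθ.immersion u hu) <| by
    rw [hc u hu, hcb u hu, hzero, zero_smul]
  refine ⟨SignType.sign (b u), fun h => hb0 (by rw [← sign_mul_abs (b u), h, zero_mul]), ?_⟩
  filter_upwards [hθ.isOpen.mem_nhds hu,
    ((continuousAt_sign_of_ne_zero hb0).comp hb).eventually_mem
      ((isOpen_discrete {SignType.sign (b u)}).mem_nhds rfl)] with w hw hsign
  have hsign : SignType.sign (b w) = SignType.sign (b u) := hsign
  rw [density_eq_abs (hW hw) (hc w hw), ← hsign, hcb w hw, sign_mul_abs, ← hcb w hw, hc w hw]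

lemma exists_oriented_chart (hS : S.charLocus = ∅) (hg : g ∈ S.carrier) (hV : V ∈ 𝓝 g) :
    ∃ O U θ π, IsChart S.carrier O U θ π ∧ g ∈ O ∧ O ⊆ V ∩ S.dom g ∧ ∃ s : ℝ, s ≠ 0 ∧
      ∀ u ∈ U, patchNormal θ u = (s * density θ u) • hnormal (S.φ g) (θ u) := by
  obtain ⟨O, U, θ, π, hc, hgO, hOV⟩ := S.exists_chart hg hV
  have hu := (hc.inv g ⟨hg, hgO⟩).1
  obtain ⟨s, hs, hev⟩ := S.eventually_patchNormal_eq hS hc.isPatch hg hu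
    fun w hw => (hOV (hc.mapsTo_nhd hw)).2
  obtain ⟨U', hU', hU'o, hgU'⟩ := mem_nhds_iff.1 (inter_mem (hc.isOpen.mem_nhds hu) hev)
  exact ⟨_, U', θ, π, hc.restrict hU'o fun w hw => (hU' hw).1, ⟨hgO, hgU'⟩,
    Set.inter_subset_left.trans hOV, s, hs, fun w hw => (hU' hw).2⟩

end OrientedC2Surface

end Charts

section Stokes

variable {M O K : Set Heis} {U : Set (ℝ × ℝ)} {θ : ℝ × ℝ → Heis} {π : Heis →L[ℝ] ℝ × ℝ}
  {α : Heis → Fin 3 → ℝ} {u : ℝ × ℝ}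

/-- The pull-back under `θ` of the one-form with components `α` in the frame dual to
`X₁, X₂, T`, evaluated at the constant vector `v`. -/
def pullback (θ : ℝ × ℝ → Heis) (α : Heis → Fin 3 → ℝ) (v u : ℝ × ℝ) : ℝ :=
  α (θ u) ⬝ᵥ frameCoord (θ u) (fderiv ℝ θ u v)

lemma contDiffAt_pullback (hθ : ContDiffAt ℝ 2 θ u) (hα : ContDiffAt ℝ 1 α (θ u)) (v : ℝ × ℝ) :
    ContDiffAt ℝ 1 (pullback θ α v) u := by
  have hθ1 : ContDiffAt ℝ 1 θ u := hθ.of_le one_le_two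
  have : ContDiffAt ℝ 1 (fun u => fderiv ℝ θ u v) u :=
    (hθ.fderiv_right (m := 1) (by norm_num)).clm_apply contDiffAt_const
  have hαθ := contDiffAt_pi.1 (hα.comp u hθ1)
  simp only [Function.comp_apply] at hαθ
  unfold pullback frameCoord
  simp only [vec3_dotProduct, cons_val_zero, cons_val_one, cons_val]
  have := hαθ 0
  have := hαθ 1
  have := hαθ 2
  fun_prop

lemma fderiv_pullback (hθ : ContDiffAt ℝ 2 θ u) (hα : DifferentiableAt ℝ α (θ u)) (v w : ℝ × ℝ) :
    fderiv ℝ (pullback θ α v) u w =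
      fderiv ℝ α (θ u) (fderiv ℝ θ u w) ⬝ᵥ frameCoord (θ u) (fderiv ℝ θ u v) +
      α (θ u) ⬝ᵥ frameCoord (θ u) (fderiv ℝ (fderiv ℝ θ) u w v) +
      α (θ u) 2 * ((fderiv ℝ θ u w).2.1 / 2 * (fderiv ℝ θ u v).1 -
        (fderiv ℝ θ u w).1 / 2 * (fderiv ℝ θ u v).2.1) := by
  have hθ' := (hθ.differentiableAt two_ne_zero).hasFDerivAt
  have hv : HasFDerivAt (fun u => fderiv ℝ θ u v)
      ((ContinuousLinearMap.apply ℝ Heis v).comp (fderiv ℝ (fderiv ℝ θ) u)) u :=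
    (ContinuousLinearMap.apply ℝ Heis v).hasFDerivAt.comp u
      ((hθ.fderiv_right (m := 1) (by norm_num)).differentiableAt one_ne_zero).hasFDerivAt
  have hαθ := hasFDerivAt_pi'.1 (hα.hasFDerivAt.comp u hθ')
  have hsum := (((hαθ 0).mul hv.fst).add ((hαθ 1).mul hv.snd.fst)).add ((hαθ 2).mul
    ((hv.snd.snd.add ((hθ'.snd.fst.mul_const (1 / 2)).mul hv.fst)).sub
      ((hθ'.fst.mul_const (1 / 2)).mul hv.snd.fst)))
  have hpullback : HasFDerivAt (pullback θ α v) _ u :=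
    hsum.congr_of_eventuallyEq <| Eventually.of_forall fun u => by
      simp only [pullback, frameCoord, vec3_dotProduct, cons_val_zero, cons_val_one, cons_val,
        Pi.add_apply, Pi.mul_apply, Pi.sub_apply, Function.comp_apply]
      ring
  rw [hpullback.fderiv, vec3_dotProduct, vec3_dotProduct]
  simp only [frameCoord, cons_val_zero, cons_val_one, cons_val, one_div, smul_eq_mul,
    Function.comp_apply, Pi.sub_apply, Pi.add_apply, Pi.mul_apply, _root_.add_apply,
    _root_.smul_apply, _root_.sub_apply, ContinuousLinearMap.comp_apply,
    ContinuousLinearMap.apply_apply, ContinuousLinearMap.coe_fst', ContinuousLinearMap.coe_snd',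
    ContinuousLinearMap.proj_apply]
  ring

lemma fderiv_pullback_sub (hθ : ContDiffAt ℝ 2 θ u) (hα : DifferentiableAt ℝ α (θ u)) :
    fderiv ℝ (pullback θ α (0, 1)) u (1, 0) - fderiv ℝ (pullback θ α (1, 0)) u (0, 1) =
      patchNormal θ u ⬝ᵥ curl α (θ u) := by
  have hsymm : fderiv ℝ (fderiv ℝ θ) u (1, 0) (0, 1) = fderiv ℝ (fderiv ℝ θ) u (0, 1) (1, 0) :=
    (hθ.isSymmSndFDerivAt (by simp)).eq _ _
  have hframe (v : Heis) (i : Fin 3) : fderiv ℝ α (θ u) v i =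
      frameCoord (θ u) v 0 * fderiv ℝ α (θ u) (X1 (θ u)) i +
      frameCoord (θ u) v 1 * fderiv ℝ α (θ u) (X2 (θ u)) i +
      frameCoord (θ u) v 2 * fderiv ℝ α (θ u) (T (θ u)) i := by
    conv_lhs => rw [← frameCoord_spec (θ u) v]
    simp only [map_add, map_smul, Pi.add_apply, Pi.smul_apply, smul_eq_mul]
  rw [fderiv_pullback hθ hα, fderiv_pullback hθ hα, hsymm, patchNormal, curl]
  simp only [vec3_dotProduct, cross_apply, hframe (fderiv ℝ θ u _)]
  simp only [frameCoord, cons_val_zero, cons_val_one, cons_val]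
  ring

lemma IsChart.setIntegral_patchNormal_dotProduct_curl_eq_zero (h : IsChart M O U θ π)
    (hα : ∀ g ∈ M ∩ O, ContDiffAt ℝ 1 α g) (hK : IsCompact K) (hKM : K ⊆ M ∩ O)
    (h0 : ∀ g ∈ M ∩ O, g ∉ K → α g = 0) :
    ∫ u in U, patchNormal θ u ⬝ᵥ curl α (θ u) = 0 := by
  have hθ {u} (hu : u ∈ U) : ContDiffAt ℝ 2 θ u := h.contDiffOn.contDiffAt (h.isOpen.mem_nhds hu)
  have hMO {u} (hu : u ∈ U) : θ u ∈ M ∩ O := ⟨h.mapsTo hu, h.mapsTo_nhd hu⟩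
  have hKU : π '' K ⊆ U := Set.image_subset_iff.2 fun g hg => (h.inv g (hKM hg)).1
  have hpull (v : ℝ × ℝ) : ContDiffOn ℝ 1 (pullback θ α v) U := fun u hu =>
    (contDiffAt_pullback (hθ hu) (hα _ (hMO hu)) v).contDiffWithinAt
  have hzero (v : ℝ × ℝ) : ∀ u ∈ U \ π '' K, pullback θ α v u = 0 := fun u hu => by
    rw [pullback, h0 _ (hMO hu.1) fun hK => hu.2 ⟨_, hK, h.proj_apply u hu.1⟩, zero_dotProduct]
  have hint (v w : ℝ × ℝ) := integrableOn_fderiv_apply volume h.isOpen (hK.image π.continuous) hKU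
    (hpull v) (hzero v) w
  have hint0 (v w : ℝ × ℝ) := setIntegral_fderiv_apply_eq_zero volume h.isOpen
    (hK.image π.continuous) hKU (hpull v) (hzero v) w
  calc ∫ u in U, patchNormal θ u ⬝ᵥ curl α (θ u)
      = ∫ u in U, fderiv ℝ (pullback θ α (0, 1)) u (1, 0) -
          fderiv ℝ (pullback θ α (1, 0)) u (0, 1) :=
        setIntegral_congr_fun h.isOpen.measurableSet fun u hu =>
          (fderiv_pullback_sub (hθ hu) ((hα _ (hMO hu)).differentiableAt one_ne_zero)).symm
    _ = 0 := by rw [integral_sub (hint _ _) (hint _ _), hint0, hint0, sub_zero]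

namespace OrientedC2Surface

variable {S : OrientedC2Surface} {g : Heis}

lemma integrableOn_of_compact (hK : IsCompact K) (hKS : K ⊆ S.carrier)
    (hfin : perimeter S.carrier K < ⊤) {F : Heis → ℝ} (hF : ContinuousOn F S.carrier)
    (h0 : ∀ g ∈ S.carrier, g ∉ K → F g = 0) :
    IntegrableOn F S.carrier (perimeter S.carrier) := by
  have hm := S.measurableSet_carrier
  refine IntegrableOn.of_forall_sdiff_eq_zero (s := K) ?_ hm fun g hg => h0 g hg.1 hg.2
  obtain ⟨C, hC⟩ := hK.exists_bound_of_continuousOn (hF.mono hKS)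
  exact Measure.integrableOn_of_bounded hfin.ne
    (perimeter_restrict_self hm ▸ hF.aestronglyMeasurable hm)
    (ae_restrict_of_forall_mem hK.measurableSet hC)

namespace IsLocalExtension

variable {α : Heis → Heis → Fin 3 → ℝ}

lemma dotProduct_curl_eq_zero (hS : S.charLocus = ∅) (hα : S.IsLocalExtension α) (hK : IsClosed K)
    (h0 : ∀ g ∈ S.carrier, g ∉ K → α g g = 0) (hg : g ∈ S.carrier) (hgK : g ∉ K) :
    hnormal (S.φ g) g ⬝ᵥ curl (α g) g = 0 := by
  have hev : α g =ᶠ[𝓝[S.carrier] g] 0 := by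
    filter_upwards [self_mem_nhdsWithin, mem_nhdsWithin_of_mem_nhds (hK.isOpen_compl.mem_nhds hgK),
      hα.eventually_eq g hg] with h hh hhK hgh using hgh.trans (h0 h hh hhK)
  rw [S.dotProduct_curl_congr hS hg (hα.contDiffAt g hg) contDiffAt_const hev]
  simp [curl]

lemma integrableOn_dotProduct_curl (hS : S.charLocus = ∅) (hα : S.IsLocalExtension α)
    (hK : IsCompact K) (hKS : K ⊆ S.carrier) (hfin : perimeter S.carrier K < ⊤)
    (h0 : ∀ g ∈ S.carrier, g ∉ K → α g g = 0) :
    IntegrableOn (fun g => hnormal (S.φ g) g ⬝ᵥ curl (α g) g) S.carrier (perimeter S.carrier) :=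
  S.integrableOn_of_compact hK hKS hfin (hα.continuousOn_dotProduct_curl hS)
    fun _ hg hgK => hα.dotProduct_curl_eq_zero hS hK.isClosed h0 hg hgK

lemma integral_dotProduct_curl_eq_zero_of_isChart (hS : S.charLocus = ∅)
    (hα : S.IsLocalExtension α) (hg : g ∈ S.carrier) (hc : IsChart S.carrier O U θ π)
    (hO : O ⊆ S.dom g) {s : ℝ} (hs : s ≠ 0)
    (hN : ∀ u ∈ U, patchNormal θ u = (s * density θ u) • hnormal (S.φ g) (θ u))
    (hαO : ∀ h ∈ S.carrier ∩ O, ContDiffAt ℝ 1 (α g) h ∧ α g =ᶠ[𝓝[S.carrier] h] α h)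
    (hK : IsCompact K) (hKO : K ⊆ S.carrier ∩ O) (h0 : ∀ h ∈ S.carrier, h ∉ K → α h h = 0) :
    ∫ h in S.carrier, hnormal (S.φ h) h ⬝ᵥ curl (α h) h ∂(perimeter S.carrier) = 0 := by
  have hm := S.measurableSet_carrier
  have hmO := hc.isOpen_nhd.measurableSet
  have hlocal : ∀ u ∈ U, patchNormal θ u ⬝ᵥ curl (α g) (θ u) =
      s * (density θ u * (hnormal (S.φ (θ u)) (θ u) ⬝ᵥ curl (α (θ u)) (θ u))) := fun u hu => by
    have hu' := hc.mapsTo hu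
    have hαu := hαO _ ⟨hu', hc.mapsTo_nhd hu⟩
    rw [hN u hu, S.hnormal_eq hg hu' (hO (hc.mapsTo_nhd hu)), smul_dotProduct,
      S.dotProduct_curl_congr hS hu' hαu.1 (hα.contDiffAt _ hu') hαu.2, smul_eq_mul, mul_assoc]
  have hchart := hc.setIntegral_patchNormal_dotProduct_curl_eq_zero
    (fun h hh => (hαO h hh).1) hK hKO fun h hh hhK => by
      rw [(hαO h hh).2.self_of_nhdsWithin hh.1, h0 h hh.1 hhK]
  rw [setIntegral_congr_fun hc.isOpen.measurableSet hlocal, integral_const_mul] at hchart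
  have hrestrict : ((perimeter S.carrier).restrict S.carrier).restrict O = patchPerimeter U θ := by
    rw [perimeter_restrict_self hm, hc.perimeter_restrict]
  have hsm : AEStronglyMeasurable (fun h => hnormal (S.φ h) h ⬝ᵥ curl (α h) h)
      (patchPerimeter U θ) :=
    hrestrict ▸ ((hα.continuousOn_dotProduct_curl hS).aestronglyMeasurable hm).restrict
  rw [setIntegral_eq_of_subset_of_forall_sdiff_eq_zero hm Set.inter_subset_left fun h hh =>
      hα.dotProduct_curl_eq_zero hS hK.isClosed h0 hh.1 fun hK => hh.2 (hKO hK),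
    Set.inter_comm, ← Measure.restrict_restrict hmO, hrestrict,
    integral_patchPerimeter hc.isOpen hc.isPatch.contDiffOn hsm]
  exact (mul_eq_zero.1 hchart).resolve_left hs

lemma exists_nhds_integral_dotProduct_curl_smul_eq_zero (hS : S.charLocus = ∅)
    (hα : S.IsLocalExtension α) (hK : IsCompact K) (hKS : K ⊆ S.carrier)
    (h0 : ∀ g ∈ S.carrier, g ∉ K → α g g = 0) (hg : g ∈ S.carrier) :
    ∃ O ∈ 𝓝 g, ∀ ρ : Heis → ℝ, ContDiff ℝ 1 ρ → tsupport ρ ⊆ O →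
      ∫ h in S.carrier, hnormal (S.φ h) h ⬝ᵥ curl (ρ • α h) h ∂(perimeter S.carrier) = 0 := by
  obtain ⟨O, U, θ, π, hc, hgO, hOV, s, hs, hN⟩ := S.exists_oriented_chart hS hg
    (mem_nhdsWithin_iff_eventually.1 (hα.eventually_contDiffAt_and_eventuallyEq hg))
  refine ⟨O, hc.isOpen_nhd.mem_nhds hgO, fun ρ hρ hρO => ?_⟩
  refine (hα.smul hρ).integral_dotProduct_curl_eq_zero_of_isChart hS hg hc
    (hOV.trans Set.inter_subset_right) hs hN (fun h hh => ?_)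
    (hK.inter_right (isClosed_tsupport ρ)) (fun h hh => ⟨hKS hh.1, hρO hh.2⟩) fun h hh hhK => ?_
  · obtain ⟨hC1, heq⟩ := (hOV hh.2).1 hh.1
    exact ⟨hρ.contDiffAt.smul hC1, heq.mono fun w hw => by simp only [Pi.smul_apply', hw]⟩
  · rw [Pi.smul_apply', smul_eq_zero]
    by_contra! hne
    exact hhK ⟨by_contra fun hK => hne.2 (h0 h hh hK), subset_tsupport ρ hne.1⟩

theorem integral_dotProduct_curl_eq_zero (hS : S.charLocus = ∅) (hα : S.IsLocalExtension α)
    (hK : IsCompact K) (hKS : K ⊆ S.carrier) (hfin : perimeter S.carrier K < ⊤)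
    (h0 : ∀ g ∈ S.carrier, g ∉ K → α g g = 0) :
    ∫ g in S.carrier, hnormal (S.φ g) g ⬝ᵥ curl (α g) g ∂(perimeter S.carrier) = 0 := by
  have hloc (g : Heis) (hg : g ∈ K) :=
    hα.exists_nhds_integral_dotProduct_curl_smul_eq_zero hS hK hKS h0 (hKS hg)
  choose! O hO hzero using hloc
  obtain ⟨t, ρ, hρ, hsum⟩ := exists_finset_partition_of_unity hK hO
  have hρ1 (i : t) : ContDiff ℝ 1 (ρ i) := (hρ i).2.1.of_le (by simp)
  have hsplit : ∀ g ∈ S.carrier, hnormal (S.φ g) g ⬝ᵥ curl (α g) g =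
      ∑ i, hnormal (S.φ g) g ⬝ᵥ curl (ρ i • α g) g := fun g hg => by
    have hC1 (i : t) := (hα.smul (hρ1 i)).contDiffAt g hg
    rw [← dotProduct_sum, ← curl_sum fun i _ => (hC1 i).differentiableAt one_ne_zero]
    have hsumC1 : ContDiffAt ℝ 1 (∑ i, ρ i • α g) g := by
      rw [Finset.sum_fn]
      exact ContDiffAt.sum fun i _ => hC1 i
    refine S.dotProduct_curl_congr hS hg (hα.contDiffAt g hg) hsumC1 ?_
    filter_upwards [self_mem_nhdsWithin, hα.eventually_eq g hg] with h hh hgh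
    simp only [Finset.sum_apply, Pi.smul_apply', ← Finset.sum_smul]
    by_cases hhK : h ∈ K
    · rw [hsum h hhK, one_smul]
    · rw [hgh, h0 h hh hhK, smul_zero]
  rw [setIntegral_congr_fun S.measurableSet_carrier hsplit, integral_finsetSum _ fun i _ =>
    (hα.smul (hρ1 i)).integrableOn_dotProduct_curl hS hK hKS hfin fun g hg hgK => by
      rw [Pi.smul_apply', h0 g hg hgK, smul_zero]]
  exact Finset.sum_eq_zero fun i _ => hzero i (hρ i).1 (ρ i) (hρ1 i) (hρ i).2.2

end IsLocalExtension

end OrientedC2Surface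

end Stokes

/-! ### The second variation -/

section SecondVariation

lemma continuous_along {V : Heis → Heis} {f : Heis → ℝ} (hV : ContDiff ℝ 1 V)
    (hf : ContDiff ℝ 1 f) : Continuous (along V f) :=
  (hf.continuous_fderiv one_ne_zero).clm_apply hV.continuous

lemma density_congr {θ θ' : ℝ × ℝ → Heis} {u : ℝ × ℝ} (h : θ =ᶠ[𝓝 u] θ') :
    density θ u = density θ' u := by
  rw [density, density, patchNormal, patchNormal, h.fderiv_eq, h.eq_of_nhds]

lemma exists_homeomorph_eqOn_deform {𝒳 : Heis → Heis} {A K : Set Heis} (h𝒳 : ContDiff ℝ 1 𝒳)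
    (hK : IsCompact K) (h0 : ∀ g ∈ A, g ∉ K → 𝒳 g = 0) :
    ∀ᶠ r in 𝓝 (0 : ℝ), ∃ Φ : Heis ≃ₜ Heis, Set.EqOn Φ (deform 𝒳 r) A ∧
      ContDiff ℝ 1 Φ ∧ ContDiff ℝ 1 Φ.symm := by
  obtain ⟨χ, hχ, hχc, hχK⟩ := exists_contDiff_hasCompactSupport_eq_one hK
  have hcutoff : ContDiff ℝ 1 (χ • 𝒳) := (hχ.of_le (by simp)).smul h𝒳
  obtain ⟨L, hL⟩ := hcutoff.lipschitzWith_of_hasCompactSupport hχc.smul_right one_ne_zero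
  have hsmall : ∀ᶠ r : ℝ in 𝓝 0, ‖r‖₊ * L < 1 :=
    (Continuous.tendsto' (by fun_prop) 0 0 (by simp)).eventually_lt_const one_pos
  filter_upwards [hsmall] with r hr
  obtain ⟨Φ, hΦ, hC1, hC1symm⟩ := exists_homeomorph_id_add one_ne_zero
    (hcutoff.const_smul r) hr ((lipschitzWith_smul r).comp hL)
  refine ⟨Φ, fun g hg => ?_, hC1, hC1symm⟩
  rw [hΦ]
  change g + r • χ g • 𝒳 g = g + r • 𝒳 g
  by_cases hgK : g ∈ K
  · rw [hχK g hgK, one_smul]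
  · rw [h0 g hg hgK, smul_zero]

namespace OrientedC2Surface

variable {S : OrientedC2Surface} {a : Heis → ℝ} {g : Heis} {K E : Set Heis} {r : ℝ}

lemma continuousOn_fderiv_Z (hS : S.charLocus = ∅) (ha : ContDiff ℝ 1 a) :
    ContinuousOn (fun g => fderiv ℝ a g (Z (S.φ g) g)) S.carrier := by
  simp only [fderiv_apply_Z]
  exact ((continuousOn_qbar hS).mul (continuous_along contDiff_X1 ha).continuousOn).sub
    ((continuousOn_pbar hS).mul (continuous_along contDiff_X2 ha).continuousOn)

lemma continuousOn_normalB (hS : S.charLocus = ∅) (ha : ContDiff ℝ 1 a) :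
    ContinuousOn (fun g => normalB (S.φ g) a g) S.carrier :=
  (continuousOn_fderiv_Z hS ha).add
    (ha.continuous.continuousOn.mul (continuousOn_omegabar hS))

lemma continuousOn_normalC (hS : S.charLocus = ∅) (ha : ContDiff ℝ 1 a) :
    ContinuousOn (fun g => normalC (S.φ g) a g) S.carrier :=
  ha.continuous.continuousOn.mul
    (((continuousOn_omegabar hS).mul (continuous_along contDiff_X1 ha).continuousOn).sub
      ((continuousOn_pbar hS).mul (continuous_along contDiff_T ha).continuousOn))

lemma continuousOn_jacobian (hS : S.charLocus = ∅) (ha : ContDiff ℝ 1 a) (r : ℝ) :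
    ContinuousOn (fun g => jacobian (S.φ g) a r g) S.carrier :=
  (((continuousOn_pbar hS).pow 2).add ((((continuousOn_qbar hS).add
    (continuousOn_const.mul (continuousOn_normalB hS ha))).add
    (continuousOn_const.mul (continuousOn_normalC hS ha))).pow 2)).sqrt

lemma fderiv_Z_eq_zero_of_notMem (ha : ContDiff ℝ 1 a) (hK : IsClosed K)
    (haK : ∀ g ∈ S.carrier, g ∉ K → a g = 0) (hg : g ∈ S.carrier) (hgK : g ∉ K) :
    fderiv ℝ a g (Z (S.φ g) g) = 0 := by
  have hd := S.mem_dom g hg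
  have hev : a =ᶠ[𝓝[S.carrier] g] 0 := by
    filter_upwards [self_mem_nhdsWithin, mem_nhdsWithin_of_mem_nhds (hK.isOpen_compl.mem_nhds hgK)]
      with h hh hhK using haK h hh hhK
  rw [S.nhdsWithin_carrier hg hg hd] at hev
  obtain ⟨c, hc⟩ := exists_fderiv_eq_smul_of_eventuallyEq_zero ha.contDiffAt
    ((S.contDiffAt hg hd).of_le one_le_two) (S.fderiv_ne_zero hg hd) hev
  rw [hc, _root_.smul_apply, fderiv_Z_eq_zero, smul_zero]

lemma normalB_eq_zero_of_notMem (ha : ContDiff ℝ 1 a) (hK : IsClosed K)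
    (haK : ∀ g ∈ S.carrier, g ∉ K → a g = 0) (hg : g ∈ S.carrier) (hgK : g ∉ K) :
    normalB (S.φ g) a g = 0 := by
  rw [normalB, fderiv_Z_eq_zero_of_notMem ha hK haK hg hgK, haK g hg hgK, zero_mul, zero_add]

lemma normalC_eq_zero {φ : Heis → ℝ} (h : a g = 0) : normalC φ a g = 0 := by
  rw [normalC, h, zero_mul]

lemma exists_forall_mem_unitCoefficients (hS : S.charLocus = ∅) (ha : ContDiff ℝ 1 a)
    (hK : IsCompact K) (hKS : K ⊆ S.carrier) (haK : ∀ g ∈ S.carrier, g ∉ K → a g = 0) :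
    ∃ M, 0 ≤ M ∧ ∀ g ∈ S.carrier, (pbar (S.φ g) g, qbar (S.φ g) g, normalB (S.φ g) a g,
      normalC (S.φ g) a g) ∈ unitCoefficients M := by
  obtain ⟨M, hM⟩ := hK.exists_bound_of_continuousOn
    (((continuousOn_normalB hS ha).prodMk (continuousOn_normalC hS ha)).mono hKS)
  refine ⟨max M 0, le_max_right _ _, fun g hg => ?_⟩
  have hbound : ‖(normalB (S.φ g) a g, normalC (S.φ g) a g)‖ ≤ max M 0 := by
    by_cases hgK : g ∈ K
    · exact le_max_of_le_left (hM g hgK)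
    · rw [normalB_eq_zero_of_notMem ha hK.isClosed haK hg hgK, normalC_eq_zero (haK g hg hgK)]
      simp
  exact ⟨pbar_sq_add_qbar_sq (W_self_ne_zero hS hg), norm_prod_le_iff.1 hbound⟩

lemma deformedPerimeter_eq_lintegral (hS : S.charLocus = ∅) (ha : ContDiff ℝ 1 a)
    (hE : MeasurableSet E) (hES : E ⊆ S.carrier)
    (hpos : ∀ g ∈ S.carrier, 0 < jacobian (S.φ g) a r g)
    (hr : ∃ Φ : Heis ≃ₜ Heis, Set.EqOn Φ (deform (fun g => a g • X1 g) r) S.carrier ∧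
      ContDiff ℝ 1 Φ ∧ ContDiff ℝ 1 Φ.symm) :
    deformedPerimeter S.carrier E (fun g => a g • X1 g) r =
      ∫⁻ g in E, ENNReal.ofReal (jacobian (S.φ g) a r g) ∂(perimeter S.carrier) := by
  classical
  obtain ⟨Φ, hΦ, hC1, hC1symm⟩ := hr
  let j : Heis → ℝ := S.carrier.piecewise (fun g => jacobian (S.φ g) a r g) 1
  have hjS : Set.EqOn j (fun g => jacobian (S.φ g) a r g) S.carrier :=
    Set.piecewise_eqOn _ _ _
  have hj : Measurable j :=
    (continuousOn_jacobian hS ha r).measurable_piecewise continuousOn_const S.measurableSet_carrier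
  have hj0 (g : Heis) : 0 < j g := by
    by_cases hg : g ∈ S.carrier
    · exact (hpos g hg).trans_eq (hjS hg).symm
    · simp [j, hg]
  have hdensity (U θ) (hθ : IsPatch S.carrier U θ) (u) (hu : u ∈ U) :
      density (Φ ∘ θ) u = j (θ u) * density θ u := by
    have hg := hθ.mapsTo hu
    have heq : Φ ∘ θ =ᶠ[𝓝 u] deform (fun g => a g • X1 g) r ∘ θ := by
      filter_upwards [hθ.isOpen.mem_nhds hu] with w hw using hΦ (hθ.mapsTo hw)
    obtain ⟨c, hN⟩ := exists_patchNormal_eq_smul_hnormal hS hθ hg hu (S.mem_dom _ hg)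
    rw [density_congr heq, hjS hg]
    exact density_deform (ha.differentiable one_ne_zero _) (hθ.differentiableAt hu)
      (W_self_ne_zero hS hg) hN
  rw [deformedPerimeter, ← hΦ.image_eq, ← (hΦ.mono hES).image_eq,
    perimeter_image hC1 hC1symm hj hj0 hdensity,
    Measure.map_apply Φ.continuous.measurable (Φ.measurableEmbedding.measurableSet_image.2 hE),
    Set.preimage_image_eq _ Φ.injective, withDensity_apply _ hE]
  exact setLIntegral_congr_fun hE fun g hg => by rw [hjS (hES hg)]

lemma eventually_deformedPerimeter_eq (hS : S.charLocus = ∅) (ha : ContDiff ℝ 1 a)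
    (hK : IsCompact K) (hKS : K ⊆ S.carrier) (haK : ∀ g ∈ S.carrier, g ∉ K → a g = 0)
    (hE : MeasurableSet E) (hES : E ⊆ S.carrier) (hEfin : perimeter S.carrier E < ⊤) :
    ∀ᶠ r in 𝓝 (0 : ℝ), deformedPerimeter S.carrier E (fun g => a g • X1 g) r =
      ENNReal.ofReal (∫ g in E, jacobian (S.φ g) a r g ∂(perimeter S.carrier)) := by
  obtain ⟨M, hM, hcoeff⟩ := exists_forall_mem_unitCoefficients hS ha hK hKS haK
  obtain ⟨δ, hδ, D, hD⟩ := exists_normalLength_bound hM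
  have hfield0 : ∀ g ∈ S.carrier, g ∉ K → a g • X1 g = 0 := fun g hg hgK => by
    rw [haK g hg hgK, zero_smul]
  filter_upwards [Ioo_mem_nhds (neg_lt_zero.2 hδ) hδ,
    exists_homeomorph_eqOn_deform (ha.smul contDiff_X1) hK hfield0] with r hr hΦ
  have hbound (g) (hg : g ∈ S.carrier) := hD _ _ _ _ (hcoeff g hg) r hr
  have hint : IntegrableOn (fun g => jacobian (S.φ g) a r g) E (perimeter S.carrier) :=
    .of_bound hEfin (((continuousOn_jacobian hS ha r).mono hES).aestronglyMeasurable hE) D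
      (ae_restrict_of_forall_mem hE fun g hg => (hbound g (hES hg)).2.1)
  rw [deformedPerimeter_eq_lintegral hS ha hE hES (fun g hg => (hbound g hg).1) hΦ,
    ofReal_integral_eq_lintegral_ofReal hint (.of_forall fun g => jacobian_nonneg ..)]

lemma contDiffAt_deformedPerimeter (hS : S.charLocus = ∅) (ha : ContDiff ℝ 1 a)
    (hK : IsCompact K) (hKS : K ⊆ S.carrier) (haK : ∀ g ∈ S.carrier, g ∉ K → a g = 0)
    (hE : MeasurableSet E) (hES : E ⊆ S.carrier) (hEfin : perimeter S.carrier E < ⊤) :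
    ContDiffAt ℝ 2
        (fun r : ℝ => (deformedPerimeter S.carrier E (fun g => a g • X1 g) r).toReal) 0 ∧
      secondVariation S.carrier E (fun g => a g • X1 g) =
        ∫ g in E, (pbar (S.φ g) g ^ 2 * normalB (S.φ g) a g ^ 2 +
          2 * qbar (S.φ g) g * normalC (S.φ g) a g) ∂(perimeter S.carrier) := by
  obtain ⟨M, hM, hcoeff⟩ := exists_forall_mem_unitCoefficients hS ha hK hKS haK
  have := isFiniteMeasure_restrict.2 hEfin.ne
  have haem {F : Heis → ℝ} (hF : ContinuousOn F S.carrier) := (hF.mono hES).aemeasurable hE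
    (μ := perimeter S.carrier)
  obtain ⟨hC2, hderiv⟩ := contDiffAt_integral_normalLength (haem (continuousOn_pbar hS))
    (haem (continuousOn_qbar hS)) (haem (continuousOn_normalB hS ha))
    (haem (continuousOn_normalC hS ha)) hM
    (ae_restrict_of_forall_mem hE fun g hg => hcoeff g (hES hg))
  have hev : (fun r : ℝ => (deformedPerimeter S.carrier E (fun g => a g • X1 g) r).toReal)
      =ᶠ[𝓝 0] fun r => ∫ g in E, jacobian (S.φ g) a r g ∂(perimeter S.carrier) := by
    filter_upwards [eventually_deformedPerimeter_eq hS ha hK hKS haK hE hES hEfin] with r hr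
    rw [hr, ENNReal.toReal_ofReal (integral_nonneg fun g => jacobian_nonneg ..)]
  exact ⟨hC2.congr_of_eventuallyEq hev, hev.iteratedDeriv_eq 2 |>.trans hderiv⟩

lemma integrableOn_tangentialGradSq (hS : S.charLocus = ∅) (ha : ContDiff ℝ 1 a)
    (hK : IsCompact K) (hKS : K ⊆ S.carrier) (hKfin : perimeter S.carrier K < ⊤)
    (haK : ∀ g ∈ S.carrier, g ∉ K → a g = 0) :
    IntegrableOn (fun g => pbar (S.φ g) g ^ 2 * tangentialGradSq (S.φ g) a g)
      S.carrier (perimeter S.carrier) := by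
  have hgrad : Set.EqOn (fun g => pbar (S.φ g) g ^ 2 * tangentialGradSq (S.φ g) a g)
      (fun g => pbar (S.φ g) g ^ 2 * fderiv ℝ a g (Z (S.φ g) g) ^ 2) S.carrier := fun g hg => by
    simp only [tangentialGradSq_eq_sq (W_self_ne_zero hS hg)]
  refine S.integrableOn_of_compact hK hKS hKfin
    ((((continuousOn_pbar hS).pow 2).mul ((continuousOn_fderiv_Z hS ha).pow 2)).congr hgrad)
    fun g hg hgK => (hgrad hg).trans ?_
  simp only [fderiv_Z_eq_zero_of_notMem ha hK.isClosed haK hg hgK, zero_pow, mul_zero, ne_eq,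
    OfNat.ofNat_ne_zero, not_false_eq_true]

lemma integrableOn_sq_mul_potential (hS : S.charLocus = ∅) (ha : Continuous a)
    (hK : IsCompact K) (hKS : K ⊆ S.carrier) (hKfin : perimeter S.carrier K < ⊤)
    (haK : ∀ g ∈ S.carrier, g ∉ K → a g = 0) :
    IntegrableOn (fun g => a g ^ 2 * potential (S.φ g) g) S.carrier (perimeter S.carrier) :=
  S.integrableOn_of_compact hK hKS hKfin
    ((ha.continuousOn.pow 2).mul (continuousOn_potential hS)) fun g hg hgK => by
      rw [haK g hg hgK, zero_pow two_ne_zero, zero_mul]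

lemma integral_variation_eq (hS : S.charLocus = ∅) (ha : ContDiff ℝ 1 a)
    (hK : IsCompact K) (hKS : K ⊆ S.carrier) (hKfin : perimeter S.carrier K < ⊤)
    (haK : ∀ g ∈ S.carrier, g ∉ K → a g = 0) :
    ∫ g in S.carrier, (pbar (S.φ g) g ^ 2 * normalB (S.φ g) a g ^ 2 +
        2 * qbar (S.φ g) g * normalC (S.φ g) a g) ∂(perimeter S.carrier) =
      (∫ g in S.carrier, pbar (S.φ g) g ^ 2 * tangentialGradSq (S.φ g) a g
        ∂(perimeter S.carrier)) +
      ∫ g in S.carrier, a g ^ 2 * potential (S.φ g) g ∂(perimeter S.carrier) := by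
  have hgrad := integrableOn_tangentialGradSq hS ha hK hKS hKfin haK
  have hpot := integrableOn_sq_mul_potential hS ha.continuous hK hKS hKfin haK
  have hform : S.IsLocalExtension fun g => a ^ 2 • stokesForm (S.φ g) :=
    (isLocalExtension_stokesForm hS).smul (ha.pow 2)
  have hform0 : ∀ g ∈ S.carrier, g ∉ K → (a ^ 2 • stokesForm (S.φ g)) g = 0 :=
    fun g hg hgK => by simp [haK g hg hgK]
  have hcurl := hform.integrableOn_dotProduct_curl hS hK hKS hKfin hform0
  rw [setIntegral_congr_fun S.measurableSet_carrier fun g hg => second_variation_density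
    (S.contDiffAt hg (S.mem_dom g hg)) (W_self_ne_zero hS hg) (ha.differentiable one_ne_zero g)]
  refine (integral_add (hgrad.add hpot) hcurl).trans ?_
  rw [hform.integral_dotProduct_curl_eq_zero hS hK hKS hKfin hform0, add_zero]
  exact integral_add hgrad hpot

end OrientedC2Surface

end SecondVariation

end Heisenberg

end

theorem lemma3p6_general (S : OrientedC2Surface) (hS : S.charLocus = ∅)
    (a : Heis → ℝ) (ha : ContDiff ℝ 1 a)
    (K : Set Heis) (hK : IsCompact K) (hKS : K ⊆ S.carrier)
    (haK : ∀ g ∈ S.carrier, g ∉ K → a g = 0)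
    (E : Set Heis) (hE : MeasurableSet E) (hKE : K ⊆ E) (hES : E ⊆ S.carrier)
    (hEfin : perimeter S.carrier E < ⊤) :
    (∀ᶠ r in 𝓝 (0 : ℝ), deformedPerimeter S.carrier E (fun g => a g • X1 g) r < ⊤) ∧
    ContDiffAt ℝ 2
      (fun r : ℝ => (deformedPerimeter S.carrier E (fun g => a g • X1 g) r).toReal) 0 ∧
    IntegrableOn (fun g => pbar (S.φ g) g ^ 2 * tangentialGradSq (S.φ g) a g)
      S.carrier (perimeter S.carrier) ∧
    IntegrableOn (fun g => a g ^ 2 * potential (S.φ g) g)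
      S.carrier (perimeter S.carrier) ∧
    secondVariation S.carrier E (fun g => a g • X1 g) =
      (∫ g in S.carrier, pbar (S.φ g) g ^ 2 * tangentialGradSq (S.φ g) a g
        ∂(perimeter S.carrier)) +
      ∫ g in S.carrier, a g ^ 2 * potential (S.φ g) g ∂(perimeter S.carrier) := by
  have hKfin : perimeter S.carrier K < ⊤ := (measure_mono hKE).trans_lt hEfin
  obtain ⟨hC2, hsecond⟩ := S.contDiffAt_deformedPerimeter hS ha hK hKS haK hE hES hEfin
  refine ⟨?_, hC2, S.integrableOn_tangentialGradSq hS ha hK hKS hKfin haK,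
    S.integrableOn_sq_mul_potential hS ha.continuous hK hKS hKfin haK, ?_⟩
  · filter_upwards [S.eventually_deformedPerimeter_eq hS ha hK hKS haK hE hES hEfin] with r hr
    exact hr ▸ ENNReal.ofReal_lt_top
  · have hzero : ∀ g ∈ S.carrier \ E, pbar (S.φ g) g ^ 2 * normalB (S.φ g) a g ^ 2 +
        2 * qbar (S.φ g) g * normalC (S.φ g) a g = 0 := fun g ⟨hg, hgE⟩ => by
      have hgK := fun h => hgE (hKE h)
      rw [OrientedC2Surface.normalB_eq_zero_of_notMem ha hK.isClosed haK hg hgK,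
        OrientedC2Surface.normalC_eq_zero (haK g hg hgK)]
      ring
    rw [hsecond, ← S.integral_variation_eq hS ha hK hKS hKfin haK,
      setIntegral_eq_of_subset_of_forall_sdiff_eq_zero S.measurableSet_carrier hES hzero]

theorem lemma3p6 (S : OrientedC2Surface) (hS : S.charLocus = ∅)
    (a : Heis → ℝ) (ha : ContDiff ℝ 2 a)
    (K : Set Heis) (hK : IsCompact K) (hKS : K ⊆ S.carrier)
    (haK : ∀ g ∈ S.carrier, g ∉ K → a g = 0)
    (E : Set Heis) (hE : MeasurableSet E) (hKE : K ⊆ E) (hES : E ⊆ S.carrier)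
    (hEfin : perimeter S.carrier E < ⊤) :
    (∀ᶠ r in 𝓝 (0 : ℝ), deformedPerimeter S.carrier E (fun g => a g • X1 g) r < ⊤) ∧
    ContDiffAt ℝ 2
      (fun r : ℝ => (deformedPerimeter S.carrier E (fun g => a g • X1 g) r).toReal) 0 ∧
    IntegrableOn (fun g => pbar (S.φ g) g ^ 2 * tangentialGradSq (S.φ g) a g)
      S.carrier (perimeter S.carrier) ∧
    IntegrableOn (fun g => a g ^ 2 * potential (S.φ g) g)
      S.carrier (perimeter S.carrier) ∧
    secondVariation S.carrier E (fun g => a g • X1 g) =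
      (∫ g in S.carrier, pbar (S.φ g) g ^ 2 * tangentialGradSq (S.φ g) a g
        ∂(perimeter S.carrier)) +
      ∫ g in S.carrier, a g ^ 2 * potential (S.φ g) g ∂(perimeter S.carrier) :=
  lemma3p6_general S hS a (ha.of_le one_le_two) K hK hKS haK E hE hKE hES hEfin
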